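/- Let $n\ge 1$, $\gamma>1$, $R>0$. Consider a classical solution, global in time ($t\ge 0$, $x\in\mathbb R^n$), of the gas dynamics equations (GD) $$\partial_t\rho+\operatorname{div}(\rho v)=0,\qquad \partial_t(\rho v)+\operatorname{div}(\rho v\otimes v)+\nabla p=0,$$ $$\partial_t\left(\tfrac12\rho|v|^2+\rho e\right)+\operatorname{div}\left(\left(\tfrac12\rho|v|^2+\rho e+p\right)v\right)=0,$$ with state equations $p=(\gamma-1)\rho e=R\rho\theta$, density $\rho\ge 0$ and absolute temperature $\theta\ge 0$: here $\rho,v,p$ are continuous for $t\ge 0$ and $C^1$ for $t>0$. Suppose that the energy density $\tfrac12\rho|v|^2+\rho e$ does not vanish identically in $x$ for all sufficiently large times. Suppose that the solution belongs to the class $K_{GD}$: there are positive continuous functions $M_v,M_{Dv},M_\rho,M_p,M_\theta$ on $[0,\infty)$, real numbers $\alpha_v\le 1$, $\alpha_{Dv},\alpha_\theta$ (arbitrary), $\varepsilon>0$, and constants $R_0>0$, $T\ge 0$, such that for all $t>T$ and all $x$ with $|x|>R_0$ $$|v(t,x)|\le M_v(t)|x|^{\alpha_v},\qquad |Dv(t,x)|\le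 M_{Dv}(t)|x|^{\alpha_{Dv}},\qquad \rho(t,x)\le M_\rho(t)|x|^{-n-2-\varepsilon},$$ $$p(t,x)\le M_p(t)|x|^{-n-\varepsilon},\qquad \theta(t,x)\le M_\theta(t)|x|^{\alpha_\theta}.$$ Then, as $t\to\infty$, $M_\rho(t)$ grows at least like $t^{2+\varepsilon}$, and $\int_0^t M_v(\tau)\,d\tau$ grows at least like $\ln t$ if $\alpha_v=1$ and at least like $t^{1-\alpha_v}$ if $\alpha_v<1$. That is, there are constants $c>0$ and $t_0>1$ such that for all $t\ge t_0$ $$M_\rho(t)\ge c\,t^{2+\varepsilon},\qquad \int_0^t M_v(\tau)\,d\tau\ge c\ln t\ \ (\alpha_v=1),\qquad \int_0^t M_v(\tau)\,d\tau\ge c\,t^{1-\alpha_v}\ \ (\alpha_v<1).$$ -/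

import Mathlib

open Filter Asymptotics

/-- The state of a fluid in `ℝ × ℝⁿ`: density, velocity, pressure, specific internal energy and
absolute temperature, as functions of `(t, x)`. -/
structure FluidState (n : ℕ) where
  density : ℝ → EuclideanSpace ℝ (Fin n) → ℝ
  velocity : ℝ → EuclideanSpace ℝ (Fin n) → EuclideanSpace ℝ (Fin n)
  pressure : ℝ → EuclideanSpace ℝ (Fin n) → ℝ
  internalEnergy : ℝ → EuclideanSpace ℝ (Fin n) → ℝ
  temperature : ℝ → EuclideanSpace ℝ (Fin n) → ℝ

/-- The spatial partial derivative `∂f/∂x_j`. -/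
noncomputable def spacePartial {n : ℕ} (j : Fin n) (f : EuclideanSpace ℝ (Fin n) → ℝ)
    (x : EuclideanSpace ℝ (Fin n)) : ℝ :=
  fderiv ℝ f x (EuclideanSpace.single j 1)

/-- The energy density `ρ|v|²/2 + ρe`. -/
noncomputable def FluidState.energyDensity {n : ℕ} (w : FluidState n) (t : ℝ)
    (x : EuclideanSpace ℝ (Fin n)) : ℝ :=
  1 / 2 * w.density t x * ‖w.velocity t x‖ ^ 2 + w.density t x * w.internalEnergy t x

/-- `w` is a classical solution, global in time, of the gas dynamics equations of a polytropic gas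
with specific heat ratio `γ` and universal gas constant `R`: `ρ`, `v`, `p` are continuous for
`t ≥ 0` and of class `C¹` for `t > 0`, density and absolute temperature are nonnegative, the state
equations hold, and mass, momentum and energy are conserved without viscosity and heat
conduction. -/
structure IsGlobalGDSolution {n : ℕ} (γ R : ℝ) (w : FluidState n) : Prop where
  continuous_density :
    ContinuousOn (fun z : ℝ × EuclideanSpace ℝ (Fin n) => w.density z.1 z.2)
      (Set.Ici 0 ×ˢ Set.univ)
  continuous_velocity :
    ContinuousOn (fun z : ℝ × EuclideanSpace ℝ (Fin n) => w.velocity z.1 z.2)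
      (Set.Ici 0 ×ˢ Set.univ)
  continuous_pressure :
    ContinuousOn (fun z : ℝ × EuclideanSpace ℝ (Fin n) => w.pressure z.1 z.2)
      (Set.Ici 0 ×ˢ Set.univ)
  contDiff_density :
    ContDiffOn ℝ 1 (fun z : ℝ × EuclideanSpace ℝ (Fin n) => w.density z.1 z.2)
      (Set.Ioi 0 ×ˢ Set.univ)
  contDiff_velocity :
    ContDiffOn ℝ 1 (fun z : ℝ × EuclideanSpace ℝ (Fin n) => w.velocity z.1 z.2)
      (Set.Ioi 0 ×ˢ Set.univ)
  contDiff_pressure :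
    ContDiffOn ℝ 1 (fun z : ℝ × EuclideanSpace ℝ (Fin n) => w.pressure z.1 z.2)
      (Set.Ioi 0 ×ˢ Set.univ)
  density_nonneg : ∀ t : ℝ, 0 ≤ t → ∀ x, 0 ≤ w.density t x
  temperature_nonneg : ∀ t : ℝ, 0 ≤ t → ∀ x, 0 ≤ w.temperature t x
  /-- `p = (γ - 1) ρ e` -/
  state_energy : ∀ t : ℝ, 0 ≤ t → ∀ x,
    w.pressure t x = (γ - 1) * w.density t x * w.internalEnergy t x
  /-- `p = R ρ θ` -/
  state_temperature : ∀ t : ℝ, 0 ≤ t → ∀ x,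
    w.pressure t x = R * w.density t x * w.temperature t x
  /-- `∂ₜ ρ + div (ρ v) = 0` -/
  mass : ∀ t : ℝ, 0 < t → ∀ x,
    deriv (fun s => w.density s x) t
      + ∑ j, spacePartial j (fun y => w.density t y * w.velocity t y j) x = 0
  /-- `∂ₜ (ρ v) + div (ρ v ⊗ v) + ∇ p = 0`, componentwise -/
  momentum : ∀ t : ℝ, 0 < t → ∀ x, ∀ i : Fin n,
    deriv (fun s => w.density s x * w.velocity s x i) t
      + ∑ j, spacePartial j
          (fun y => w.density t y * w.velocity t y i * w.velocity t y j) x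
      + spacePartial i (w.pressure t) x = 0
  /-- `∂ₜ (ρ|v|²/2 + ρe) + div ((ρ|v|²/2 + ρe + p) v) = 0` -/
  energy : ∀ t : ℝ, 0 < t → ∀ x,
    deriv (fun s => w.energyDensity s x) t
      + ∑ j, spacePartial j
          (fun y => (w.energyDensity t y + w.pressure t y) * w.velocity t y j) x = 0

/-- The time-dependent coefficients `M_v, M_{Dv}, M_ρ, M_p, M_θ` of the decay bounds. -/
structure DecayCoefficients where
  v : ℝ → ℝ
  Dv : ℝ → ℝ
  ρ : ℝ → ℝ
  p : ℝ → ℝ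
  θ : ℝ → ℝ

/-- A decay coefficient is a positive continuous function on `[0, ∞)`. -/
def IsPositiveContinuous (m : ℝ → ℝ) : Prop :=
  ContinuousOn m (Set.Ici 0) ∧ ∀ t : ℝ, 0 ≤ t → 0 < m t

/-- The exponents `α_v, α_{Dv}, α_ρ, α_p, α_θ` of the decay bounds. -/
structure DecayExponents where
  v : ℝ
  Dv : ℝ
  ρ : ℝ
  p : ℝ
  θ : ℝ

/-- The class `K(M(t), α)`. The bounds are imposed at every time `t > T` on all particles at
distance more than `R₀` from the origin, i.e. at all points `x` with `|x| > R₀`, since a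
trajectory of the (`C¹`) velocity field passes through each of them. -/
structure IsOfClassK {n : ℕ} (w : FluidState n) (M : DecayCoefficients) (α : DecayExponents) :
    Prop where
  coeff_v : IsPositiveContinuous M.v
  coeff_Dv : IsPositiveContinuous M.Dv
  coeff_ρ : IsPositiveContinuous M.ρ
  coeff_p : IsPositiveContinuous M.p
  coeff_θ : IsPositiveContinuous M.θ
  bounds : ∃ R₀ T : ℝ, 0 < R₀ ∧ 0 ≤ T ∧
    ∀ t : ℝ, T < t → ∀ x : EuclideanSpace ℝ (Fin n), R₀ < ‖x‖ →
      ‖w.velocity t x‖ ≤ M.v t * ‖x‖ ^ α.v ∧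
      ‖fderiv ℝ (w.velocity t) x‖ ≤ M.Dv t * ‖x‖ ^ α.Dv ∧
      w.density t x ≤ M.ρ t * ‖x‖ ^ α.ρ ∧
      w.pressure t x ≤ M.p t * ‖x‖ ^ α.p ∧
      w.temperature t x ≤ M.θ t * ‖x‖ ^ α.θ

/-- The class `K_{GD}` with parameter `ε > 0`: it is `K(M(t), α)` with `α_v ≤ 1`,
`α_ρ = -n-2-ε`, `α_p = -n-ε` and arbitrary `α_{Dv}`, `α_θ`. -/
structure IsOfClassKGD {n : ℕ} (w : FluidState n) (M : DecayCoefficients) (α : DecayExponents)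
    (ε : ℝ) : Prop where
  isOfClassK : IsOfClassK w M α
  eps_pos : 0 < ε
  exponent_v : α.v ≤ 1
  exponent_ρ : α.ρ = -(n : ℝ) - 2 - ε
  exponent_p : α.p = -(n : ℝ) - ε

/-! The argument is a virial argument. After time `T` the decay makes every flux through large
spheres vanish in the limit, so the mass `m` and the energy `E` are constant, and the moment of
inertia `G = ∫ |x|²ρ/2` satisfies `G' = H` with `H = ∫ ρ x·v`, and `H' = ∫ (ρ|v|² + n p)`. Since `E
= ∫ (ρ|v|²/2 + p/(γ-1))`, the last integral lies between two positive multiples of `E`. As `E > 0`,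
`H` grows at least linearly and `G` exactly quadratically (`radialMomentum_growth`,
`quadratic_growth`).

This growth has to be compatible with the decay bounds. Split space at radius `r = δt`. For `G` the
inner part is at most `r²m/2` and the outer part is at most a constant times `M_ρ(t) r^(-ε)`
(`inertia_le`). For `H` the inner part is at most `r(m + E)` and the outer part is at most `2 M_v(t)
r^(α_v - 1) G` (`radialMomentum_le`). With `δ` small the inner parts absorb only a fraction of the
growth, so the outer parts must supply the rest: `M_ρ(t) ≥ c t^(2+ε)` and `M_v(t) ≥ k t^(-α_v)`. The
second bound is then integrated in time.

The conservation and virial identities are all instances of `integral_weight_balance`, with weights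
`1`, `|x|²/2` and `x_i`. -/

open MeasureTheory Set Topology

/-! ### Conservation laws tested against compactly supported functions. -/

section WeakForm

variable {n : ℕ}

/-- Partial time derivative of a `C¹` function through its total derivative. -/
theorem hasDerivAt_time {u : ℝ → EuclideanSpace ℝ (Fin n) → ℝ}
    (hu : ContDiffOn ℝ 1 (fun z : ℝ × EuclideanSpace ℝ (Fin n) => u z.1 z.2) (Ioi 0 ×ˢ univ))
    {t : ℝ} (ht : 0 < t) (x : EuclideanSpace ℝ (Fin n)) :
    HasDerivAt (fun s => u s x)
      (fderiv ℝ (fun z : ℝ × EuclideanSpace ℝ (Fin n) => u z.1 z.2) (t, x) (1, 0)) t := by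
  have hd := (hu.contDiffAt ((isOpen_Ioi.prod isOpen_univ).mem_nhds
    (show (t, x) ∈ Ioi (0 : ℝ) ×ˢ univ from ⟨ht, mem_univ _⟩))).differentiableAt one_ne_zero
  exact hd.hasFDerivAt.comp_hasDerivAt t ((hasDerivAt_id t).prodMk (hasDerivAt_const t x))

/-- Spatial derivative of a `C¹` function through its total derivative. -/
theorem hasFDerivAt_space {u : ℝ → EuclideanSpace ℝ (Fin n) → ℝ}
    (hu : ContDiffOn ℝ 1 (fun z : ℝ × EuclideanSpace ℝ (Fin n) => u z.1 z.2) (Ioi 0 ×ˢ univ))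
    {t : ℝ} (ht : 0 < t) (x : EuclideanSpace ℝ (Fin n)) :
    HasFDerivAt (u t)
      ((fderiv ℝ (fun z : ℝ × EuclideanSpace ℝ (Fin n) => u z.1 z.2) (t, x)).comp
        (ContinuousLinearMap.inr ℝ ℝ (EuclideanSpace ℝ (Fin n)))) x := by
  have hd := (hu.contDiffAt ((isOpen_Ioi.prod isOpen_univ).mem_nhds
    (show (t, x) ∈ Ioi (0 : ℝ) ×ˢ univ from ⟨ht, mem_univ _⟩))).differentiableAt one_ne_zero
  exact hd.hasFDerivAt.comp x (hasFDerivAt_prodMk_right t x)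

theorem continuousOn_deriv_time {u : ℝ → EuclideanSpace ℝ (Fin n) → ℝ}
    (hu : ContDiffOn ℝ 1 (fun z : ℝ × EuclideanSpace ℝ (Fin n) => u z.1 z.2) (Ioi 0 ×ˢ univ)) :
    ContinuousOn (fun z : ℝ × EuclideanSpace ℝ (Fin n) => deriv (fun s => u s z.2) z.1)
      (Ioi 0 ×ˢ univ) := by
  have hc := hu.continuousOn_fderiv_of_isOpen (isOpen_Ioi.prod isOpen_univ) le_rfl
  exact (hc.clm_apply continuousOn_const).congr fun z hz => (hasDerivAt_time hu hz.1 z.2).deriv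

theorem continuousOn_slice {F : Type*} [TopologicalSpace F]
    {u : ℝ → EuclideanSpace ℝ (Fin n) → F} {I : Set ℝ}
    (hu : ContinuousOn (fun z : ℝ × EuclideanSpace ℝ (Fin n) => u z.1 z.2) (I ×ˢ univ))
    {t : ℝ} (ht : t ∈ I) : Continuous (u t) := by
  rw [← continuousOn_univ]
  exact hu.comp (f := fun x => (t, x)) (by fun_prop) fun x _ => ⟨ht, mem_univ _⟩

theorem continuous_spacePartial {u : ℝ → EuclideanSpace ℝ (Fin n) → ℝ}
    (hu : ContDiffOn ℝ 1 (fun z : ℝ × EuclideanSpace ℝ (Fin n) => u z.1 z.2) (Ioi 0 ×ˢ univ))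
    {t : ℝ} (ht : 0 < t) (j : Fin n) : Continuous (spacePartial j (u t)) := by
  have hc := hu.continuousOn_fderiv_of_isOpen (isOpen_Ioi.prod isOpen_univ) le_rfl
  have h2 := continuousOn_slice
    (u := fun s y => fderiv ℝ (fun z : ℝ × EuclideanSpace ℝ (Fin n) => u z.1 z.2) (s, y)) hc ht
  have h3 : spacePartial j (u t) = fun x =>
      fderiv ℝ (fun z : ℝ × EuclideanSpace ℝ (Fin n) => u z.1 z.2) (t, x)
        (0, EuclideanSpace.single j 1) := by
    ext x
    simp [spacePartial, (hasFDerivAt_space hu ht x).fderiv]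
  rw [h3]
  exact h2.clm_apply continuous_const

theorem continuous_spacePartial_of_contDiff {φ : EuclideanSpace ℝ (Fin n) → ℝ}
    (hφ : ContDiff ℝ 1 φ) (j : Fin n) : Continuous (spacePartial j φ) :=
  (hφ.continuous_fderiv one_ne_zero).clm_apply continuous_const

/-- Integration by parts against a compactly supported test function. -/
theorem integral_mul_spacePartial {φ f : EuclideanSpace ℝ (Fin n) → ℝ} (hφ : ContDiff ℝ 1 φ)
    (hc : HasCompactSupport φ) (hf : Differentiable ℝ f) (j : Fin n)
    (hf' : Continuous (spacePartial j f)) :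
    ∫ x, φ x * spacePartial j f x = -∫ x, spacePartial j φ x * f x := by
  have hφ' : HasCompactSupport (spacePartial j φ) :=
    (hc.fderiv ℝ).comp_left (g := fun L : EuclideanSpace ℝ (Fin n) →L[ℝ] ℝ =>
      L (EuclideanSpace.single j 1)) (by simp)
  refine integral_mul_fderiv_eq_neg_fderiv_mul_of_integrable ?_ ?_ ?_
    (fun x _ => hφ.differentiable one_ne_zero x) (fun x _ => hf x)
  · exact ((continuous_spacePartial_of_contDiff hφ j).mul
      hf.continuous).integrable_of_hasCompactSupport hφ'.mul_right
  · exact (hφ.continuous.mul hf').integrable_of_hasCompactSupport hc.mul_right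
  · exact (hφ.continuous.mul hf.continuous).integrable_of_hasCompactSupport hc.mul_right

/-- Weak form of the conservation law `∂ₜ u + div F = 0`. -/
theorem hasDerivAt_integral_test {u : ℝ → EuclideanSpace ℝ (Fin n) → ℝ}
    {F : Fin n → ℝ → EuclideanSpace ℝ (Fin n) → ℝ}
    (hu : ContDiffOn ℝ 1 (fun z : ℝ × EuclideanSpace ℝ (Fin n) => u z.1 z.2) (Ioi 0 ×ˢ univ))
    (hF : ∀ j, ContDiffOn ℝ 1 (fun z : ℝ × EuclideanSpace ℝ (Fin n) => F j z.1 z.2)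
      (Ioi 0 ×ˢ univ))
    (hlaw : ∀ t : ℝ, 0 < t → ∀ x, deriv (fun s => u s x) t + ∑ j, spacePartial j (F j t) x = 0)
    {φ : EuclideanSpace ℝ (Fin n) → ℝ} (hφ : ContDiff ℝ 1 φ) (hc : HasCompactSupport φ)
    {t : ℝ} (ht : 0 < t) :
    HasDerivAt (fun s => ∫ x, φ x * u s x) (∫ x, ∑ j, spacePartial j φ x * F j t x) t := by
  have hut := continuousOn_deriv_time hu
  have hpos : ∀ s ∈ Icc (t / 2) (2 * t), 0 < s := fun s hs => by linarith [hs.1]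
  -- The time window `[t/2, 2t]` stays inside `t > 0`, where `∂ₜu` is continuous; together with the
  -- support of `φ` it is compact, which supplies the dominating function `C|φ|`.
  obtain ⟨C, hC⟩ := ((isCompact_Icc (a := t / 2) (b := 2 * t)).prod
    hc.isCompact).exists_bound_of_continuousOn
      (hut.mono fun z hz => ⟨hpos _ hz.1, mem_univ _⟩)
  have hder : HasDerivAt (fun s => ∫ x, φ x * u s x)
      (∫ x, φ x * deriv (fun s => u s x) t) t := by
    refine (hasDerivAt_integral_of_dominated_loc_of_deriv_le
      (F := fun s x => φ x * u s x) (F' := fun s x => φ x * deriv (fun s => u s x) s)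
      (s := Icc (t / 2) (2 * t)) (bound := fun x => C * |φ x|)
      (Icc_mem_nhds (by linarith) (by linarith)) ?_ ?_ ?_ ?_ ?_ ?_).2
    · filter_upwards [Ioi_mem_nhds ht] with s hs
      exact (hφ.continuous.mul (continuousOn_slice hu.continuousOn hs)).aestronglyMeasurable
    · exact (hφ.continuous.mul
        (continuousOn_slice hu.continuousOn ht)).integrable_of_hasCompactSupport hc.mul_right
    · exact (hφ.continuous.mul (continuousOn_slice
        (u := fun s x => deriv (fun s => u s x) s) hut ht)).aestronglyMeasurable
    · refine Eventually.of_forall fun x s hs => ?_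
      by_cases hx : x ∈ tsupport φ
      · have := hC (s, x) ⟨hs, hx⟩
        rw [norm_mul, mul_comm, Real.norm_eq_abs (φ x)]
        gcongr
      · simp [image_eq_zero_of_notMem_tsupport hx]
    · exact (hφ.continuous.abs.const_mul C |>.integrable_of_hasCompactSupport
        (HasCompactSupport.mul_left (hc.comp_left (g := fun r : ℝ => |r|) abs_zero)))
    · refine Eventually.of_forall fun x s hs => ?_
      have h := hasDerivAt_time hu (hpos s hs) x
      rw [← h.deriv] at h
      exact h.const_mul _
  have hFd : ∀ j, Differentiable ℝ (F j t) := fun j x =>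
    (hasFDerivAt_space (hF j) ht x).differentiableAt
  -- What remains is to replace `∂ₜu` by `-div F` and integrate by parts in each coordinate.
  convert hder using 1
  have h1 : ∀ x, φ x * deriv (fun s => u s x) t = -∑ j, φ x * spacePartial j (F j t) x := by
    intro x
    rw [← Finset.mul_sum, ← mul_neg, eq_neg_of_add_eq_zero_left (hlaw t ht x)]
  have hφ' : ∀ j, HasCompactSupport (spacePartial j φ) := fun j =>
    (hc.fderiv ℝ).comp_left (g := fun L : EuclideanSpace ℝ (Fin n) →L[ℝ] ℝ =>
      L (EuclideanSpace.single j 1)) (by simp)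
  simp_rw [h1]
  rw [integral_neg, integral_finsetSum, integral_finsetSum, ← Finset.sum_neg_distrib]
  · refine Finset.sum_congr rfl fun j _ => ?_
    rw [integral_mul_spacePartial hφ hc (hFd j) j (continuous_spacePartial (hF j) ht j), neg_neg]
  · exact fun j _ => (hφ.continuous.mul (continuous_spacePartial (hF j) ht
      j)).integrable_of_hasCompactSupport hc.mul_right
  · exact fun j _ => ((continuous_spacePartial_of_contDiff hφ j).mul
      (hFd j).continuous).integrable_of_hasCompactSupport (hφ' j).mul_right

end WeakForm

/-! ### Cutoff functions. -/

section Cutoff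

variable {n : ℕ}

theorem spacePartial_mul {f g : EuclideanSpace ℝ (Fin n) → ℝ} {x : EuclideanSpace ℝ (Fin n)}
    (hf : DifferentiableAt ℝ f x) (hg : DifferentiableAt ℝ g x) (j : Fin n) :
    spacePartial j (fun y => f y * g y) x =
      f x * spacePartial j g x + spacePartial j f x * g x := by
  simp only [spacePartial, fderiv_fun_mul hf hg]
  simp [mul_comm]

/-- Cutoff functions exhausting the space whose gradients decay like `1 / |x|`. -/
theorem exists_cutoff (n : ℕ) : ∃ (χ : ℕ → EuclideanSpace ℝ (Fin n) → ℝ) (D : ℝ), 0 ≤ D ∧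
    (∀ k, ContDiff ℝ 1 (χ k)) ∧ (∀ k, HasCompactSupport (χ k)) ∧ (∀ k x, |χ k x| ≤ 1) ∧
    (∀ k j x, |spacePartial j (χ k) x| * (1 + ‖x‖) ≤ D) ∧
    (∀ x, ∀ᶠ k in atTop, χ k x = 1) ∧ (∀ x j, ∀ᶠ k in atTop, spacePartial j (χ k) x = 0) := by
  -- One bump with radii `1` and `2` is rescaled by `k + 1`. Its gradient is then at most `D/(k+1)`
  -- and vanishes for `|x| > 2(k+1)`, so `1 + |x| ≤ 3(k+1)` wherever it matters; hence the constant
  -- `3D`.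
  let f : ContDiffBump (0 : EuclideanSpace ℝ (Fin n)) := ⟨1, 2, one_pos, one_lt_two⟩
  have hf1 : ContDiff ℝ 1 f := f.contDiff
  have hfd : Continuous (fderiv ℝ f) := hf1.continuous_fderiv one_ne_zero
  obtain ⟨D, hD⟩ := hfd.bounded_above_of_compact_support (f.hasCompactSupport.fderiv ℝ)
  have hD0 : 0 ≤ D := (norm_nonneg _).trans (hD 0)
  have hp : ∀ k : ℕ, (0 : ℝ) < (k : ℝ) + 1 := fun k => by positivity
  have hder : ∀ (k : ℕ) j x, spacePartial j (fun x => f (((k : ℝ) + 1)⁻¹ • x)) x =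
      ((k : ℝ) + 1)⁻¹ * fderiv ℝ f (((k : ℝ) + 1)⁻¹ • x) (EuclideanSpace.single j 1) := by
    intro k j x
    have h := ((hf1.differentiable one_ne_zero (((k : ℝ) + 1)⁻¹ • x)).hasFDerivAt.comp x
      ((hasFDerivAt_id x).const_smul ((k : ℝ) + 1)⁻¹)).fderiv
    simp only [Function.comp_def] at h
    simp [spacePartial, h]
  have hlarge : ∀ x : EuclideanSpace ℝ (Fin n), ∀ᶠ k : ℕ in atTop,
      ((k : ℝ) + 1)⁻¹ • x ∈ Metric.ball (0 : EuclideanSpace ℝ (Fin n)) 1 := by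
    intro x
    obtain ⟨N, hN⟩ := exists_nat_gt ‖x‖
    filter_upwards [eventually_ge_atTop N] with k hk
    have hk' : (N : ℝ) ≤ k := by exact_mod_cast hk
    rw [mem_ball_zero_iff, norm_smul, norm_inv, Real.norm_of_nonneg (hp k).le,
      inv_mul_lt_iff₀ (hp k)]
    linarith
  refine ⟨fun k x => f (((k : ℝ) + 1)⁻¹ • x), 3 * D, by positivity, fun k =>
    hf1.comp (contDiff_id.const_smul _), fun k =>
    f.hasCompactSupport.comp_smul (inv_ne_zero (hp k).ne'), fun k x => ?_, fun k j x => ?_,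
    fun x => ?_, fun x j => ?_⟩
  · rw [abs_of_nonneg f.nonneg]; exact f.le_one
  · rw [hder, abs_mul, abs_of_pos (inv_pos.2 (hp k))]
    by_cases hx : ‖x‖ ≤ 2 * ((k : ℝ) + 1)
    · have h1 : |fderiv ℝ f (((k : ℝ) + 1)⁻¹ • x) (EuclideanSpace.single j 1)| ≤ D := by
        refine ((fderiv ℝ f (((k : ℝ) + 1)⁻¹ • x)).le_opNorm _).trans ?_
        simpa using hD (((k : ℝ) + 1)⁻¹ • x)
      have h2 : 1 + ‖x‖ ≤ 3 * ((k : ℝ) + 1) := by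
        have : (0 : ℝ) ≤ k := Nat.cast_nonneg k
        linarith
      calc _ ≤ ((k : ℝ) + 1)⁻¹ * D * (3 * ((k : ℝ) + 1)) := by gcongr
        _ = 3 * D := by field_simp [(hp k).ne']
    · have : fderiv ℝ f (((k : ℝ) + 1)⁻¹ • x) = 0 := by
        by_contra h
        have h3 := support_fderiv_subset ℝ (f := f) h
        rw [f.tsupport_eq, mem_closedBall_zero_iff, norm_smul, norm_inv,
          Real.norm_of_nonneg (hp k).le, inv_mul_le_iff₀ (hp k)] at h3
        exact hx (by linarith [show f.rOut = 2 from rfl])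
      simp [this, hD0]
  · filter_upwards [hlarge x] with k hk
    exact f.one_of_mem_closedBall (Metric.ball_subset_closedBall hk)
  · filter_upwards [hlarge x] with k hk
    have h1 : (f : EuclideanSpace ℝ (Fin n) → ℝ) =ᶠ[𝓝 (((k : ℝ) + 1)⁻¹ • x)] fun _ => 1 :=
      f.eventuallyEq_one_of_mem_ball hk
    simp [hder, h1.fderiv_eq]

end Cutoff

/-! ### Weighted balance laws on the whole space. -/

section Balance

variable {n : ℕ}

/-- Balance law for the weighted total amount `∫ ψ u` of a conserved quantity with integrable
decay: the fluxes through large spheres disappear. -/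
theorem integral_weight_balance {u : ℝ → EuclideanSpace ℝ (Fin n) → ℝ}
    {F : Fin n → ℝ → EuclideanSpace ℝ (Fin n) → ℝ}
    (hu : ContDiffOn ℝ 1 (fun z : ℝ × EuclideanSpace ℝ (Fin n) => u z.1 z.2) (Ioi 0 ×ˢ univ))
    (hF : ∀ j, ContDiffOn ℝ 1 (fun z : ℝ × EuclideanSpace ℝ (Fin n) => F j z.1 z.2)
      (Ioi 0 ×ˢ univ))
    (hlaw : ∀ t : ℝ, 0 < t → ∀ x, deriv (fun s => u s x) t + ∑ j, spacePartial j (F j t) x = 0)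
    {ψ g : EuclideanSpace ℝ (Fin n) → ℝ} (hψ : ContDiff ℝ 1 ψ) (hg : Integrable g)
    {a b : ℝ} (ha : 0 < a) (hab : a ≤ b)
    (hψu : ∀ t ∈ Icc a b, ∀ x, |ψ x * u t x| ≤ g x)
    (hψF : ∀ j, ∀ t ∈ Icc a b, ∀ x, |ψ x * F j t x| ≤ (1 + ‖x‖) * g x)
    (hdψF : ∀ j, ∀ t ∈ Icc a b, ∀ x, |spacePartial j ψ x * F j t x| ≤ g x) :
    ContinuousOn (fun t => ∫ x, ∑ j, spacePartial j ψ x * F j t x) (Icc a b) ∧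
    (∫ x, ψ x * u b x) - (∫ x, ψ x * u a x) =
      ∫ t in a..b, ∫ x, ∑ j, spacePartial j ψ x * F j t x := by
  obtain ⟨χ, D, hD, hχ, hχc, hχ1, hχD, hχt, hχd⟩ := exists_cutoff n
  have hg0 : ∀ x, 0 ≤ g x := fun x => (abs_nonneg _).trans (hψu a ⟨le_rfl, hab⟩ x)
  have hpos : ∀ t ∈ Icc a b, 0 < t := fun t ht => ha.trans_le ht.1
  have hFc : ∀ j, ∀ t ∈ Icc a b, Continuous (F j t) := fun j t ht =>
    continuousOn_slice (hF j).continuousOn (hpos t ht)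
  have hFt : ∀ j x, ContinuousOn (fun t => F j t x) (Icc a b) := fun j x =>
    (hF j).continuousOn.comp (f := fun t => (t, x)) (by fun_prop)
      fun t ht => ⟨hpos t ht, mem_univ _⟩
  have hχψ : ∀ k, ContDiff ℝ 1 (fun x => χ k x * ψ x) := fun k => (hχ k).mul hψ
  have hprod : ∀ k j x, spacePartial j (fun y => χ k y * ψ y) x =
      χ k x * spacePartial j ψ x + spacePartial j (χ k) x * ψ x := fun k j x =>
    spacePartial_mul ((hχ k).differentiable one_ne_zero x) (hψ.differentiable one_ne_zero x) j
  -- The flux term `ψF` may exceed the integrable function `g` by a factor `1 + |x|`; the gradient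
  -- of the cutoff, at most `D/(1 + |x|)`, compensates exactly that. The bound does not depend on
  -- `k`, so dominated convergence applies in `x` and in `t`.
  have hbound : ∀ k, ∀ t ∈ Icc a b, ∀ x,
      ‖∑ j, spacePartial j (fun y => χ k y * ψ y) x * F j t x‖ ≤ n * (1 + D) * g x := by
    intro k t ht x
    refine (norm_sum_le _ _).trans ((Finset.sum_le_card_nsmul _ _ ((1 + D) * g x) ?_).trans ?_)
    · intro j _
      rw [hprod, Real.norm_eq_abs,
        show (χ k x * spacePartial j ψ x + spacePartial j (χ k) x * ψ x) * F j t x =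
          χ k x * (spacePartial j ψ x * F j t x) + spacePartial j (χ k) x * (ψ x * F j t x) by
          ring]
      refine (abs_add_le _ _).trans ?_
      rw [abs_mul, abs_mul (spacePartial j (χ k) x), add_mul]
      refine add_le_add ?_ ?_
      · exact mul_le_mul (hχ1 k x) (hdψF j t ht x) (abs_nonneg _) zero_le_one
      · calc _ ≤ |spacePartial j (χ k) x| * ((1 + ‖x‖) * g x) := by gcongr; exact hψF j t ht x
          _ = |spacePartial j (χ k) x| * (1 + ‖x‖) * g x := by ring
          _ ≤ D * g x := by gcongr; exacts [hg0 x, hχD k j x]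
    · simp [mul_assoc]
  have hgn : Integrable (fun x => n * (1 + D) * g x) := hg.const_mul _
  have hK : ∀ k, ContinuousOn
      (fun t => ∫ x, ∑ j, spacePartial j (fun y => χ k y * ψ y) x * F j t x) (Icc a b) := by
    intro k
    refine continuousOn_of_dominated (bound := fun x => n * (1 + D) * g x) (fun t ht => ?_)
      (fun t ht => Eventually.of_forall fun x => hbound k t ht x) hgn
      (Eventually.of_forall fun x => ?_)
    · exact (continuous_finsetSum _ fun j _ => (continuous_spacePartial_of_contDiff (hχψ k)
        j).mul (hFc j t ht)).aestronglyMeasurable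
    · exact continuousOn_finsetSum _ fun j _ => continuousOn_const.mul (hFt j x)
  have hbal : ∀ k, (∫ t in a..b, ∫ x, ∑ j, spacePartial j (fun y => χ k y * ψ y) x * F j t x) =
      (∫ x, χ k x * ψ x * u b x) - ∫ x, χ k x * ψ x * u a x := by
    intro k
    refine intervalIntegral.integral_eq_sub_of_hasDerivAt
      (f := fun t => ∫ x, χ k x * ψ x * u t x) (fun t ht => ?_)
      (ContinuousOn.intervalIntegrable (by rw [uIcc_of_le hab]; exact hK k))
    rw [uIcc_of_le hab] at ht
    exact hasDerivAt_integral_test hu hF hlaw (hχψ k) (hχc k).mul_right (hpos t ht)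
  have hlim : ∀ t ∈ Icc a b, Tendsto (fun k => ∫ x, χ k x * ψ x * u t x) atTop
      (𝓝 (∫ x, ψ x * u t x)) := by
    intro t ht
    refine tendsto_integral_of_dominated_convergence g (fun k => ?_) hg
      (fun k => Eventually.of_forall fun x => ?_) (Eventually.of_forall fun x => ?_)
    · exact ((hχψ k).continuous.mul
        (continuousOn_slice hu.continuousOn (hpos t ht))).aestronglyMeasurable
    · rw [mul_assoc, norm_mul]
      exact (mul_le_mul (hχ1 k x) (hψu t ht x) (abs_nonneg _) zero_le_one).trans (one_mul _).le
    · refine tendsto_const_nhds.congr' ?_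
      filter_upwards [hχt x] with k hk
      rw [hk, one_mul]
  have hKlim : ∀ t ∈ Icc a b, Tendsto
      (fun k => ∫ x, ∑ j, spacePartial j (fun y => χ k y * ψ y) x * F j t x) atTop
      (𝓝 (∫ x, ∑ j, spacePartial j ψ x * F j t x)) := by
    intro t ht
    refine tendsto_integral_of_dominated_convergence (fun x => n * (1 + D) * g x) (fun k => ?_)
      hgn (fun k => Eventually.of_forall fun x => hbound k t ht x)
      (Eventually.of_forall fun x => ?_)
    · exact (continuous_finsetSum _ fun j _ => (continuous_spacePartial_of_contDiff (hχψ k)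
        j).mul (hFc j t ht)).aestronglyMeasurable
    · refine tendsto_finsetSum _ fun j _ => tendsto_const_nhds.congr' ?_
      filter_upwards [hχt x, hχd x j] with k h1 h2
      rw [hprod, h1, h2, one_mul, zero_mul, add_zero]
  have hsum : ∀ t ∈ Icc a b, ∀ x, ‖∑ j, spacePartial j ψ x * F j t x‖ ≤ n * g x := by
    intro t ht x
    refine (norm_sum_le _ _).trans ((Finset.sum_le_card_nsmul _ _ (g x)
      fun j _ => hdψF j t ht x).trans (by simp))
  refine ⟨?_, ?_⟩
  · refine continuousOn_of_dominated (bound := fun x => n * g x) (fun t ht => ?_)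
      (fun t ht => Eventually.of_forall fun x => hsum t ht x) (hg.const_mul _)
      (Eventually.of_forall fun x => ?_)
    · exact (continuous_finsetSum _ fun j _ => (continuous_spacePartial_of_contDiff hψ
        j).mul (hFc j t ht)).aestronglyMeasurable
    · exact continuousOn_finsetSum _ fun j _ => continuousOn_const.mul (hFt j x)
  · refine tendsto_nhds_unique
      ((hlim b ⟨hab, le_rfl⟩).sub (hlim a ⟨le_rfl, hab⟩)) ?_
    simp_rw [← hbal]
    refine intervalIntegral.tendsto_integral_filter_of_dominated_convergence
      (fun _ => ∫ x, n * (1 + D) * g x) (Eventually.of_forall fun k => ?_)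
      (Eventually.of_forall fun k => Eventually.of_forall fun t ht => ?_)
      intervalIntegrable_const (Eventually.of_forall fun t ht => ?_)
    · rw [uIoc_of_le hab]
      exact ((hK k).mono Ioc_subset_Icc_self).aestronglyMeasurable measurableSet_Ioc
    · rw [uIoc_of_le hab] at ht
      exact norm_integral_le_of_norm_le hgn
        (Eventually.of_forall fun x => hbound k t (Ioc_subset_Icc_self ht) x)
    · rw [uIoc_of_le hab] at ht
      exact hKlim t (Ioc_subset_Icc_self ht)

end Balance

/-! ### Decay bounds uniform over compact time intervals. -/

section Decay

variable {n : ℕ}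

/-- Outside the ball `|x|` and `1 + |x|` are comparable, with ratio between `1` and `1 + 1/R₀`. The
lower comparison serves `s ≥ 0` and the upper one `s ≤ 0`. -/
theorem exists_rpow_norm_le_rpow_one_add {E : Type*} [NormedAddCommGroup E] {R₀ : ℝ}
    (hR₀ : 0 < R₀) {s s' : ℝ} (hs : s ≤ s') :
    ∃ L : ℝ, 0 ≤ L ∧ ∀ x : E, R₀ < ‖x‖ → ‖x‖ ^ s ≤ L * (1 + ‖x‖) ^ s' := by
  refine ⟨(1 + R₀⁻¹) ^ |s|, by positivity, fun x hx => ?_⟩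
  have hx0 : 0 < ‖x‖ := hR₀.trans hx
  have hL : 1 ≤ 1 + R₀⁻¹ := le_add_of_nonneg_right (inv_nonneg.2 hR₀.le)
  have h1 : (1 + ‖x‖) ^ s ≤ (1 + ‖x‖) ^ s' :=
    Real.rpow_le_rpow_of_exponent_le (by linarith) hs
  refine le_trans ?_ (mul_le_mul_of_nonneg_left h1 (by positivity))
  rcases le_total 0 s with h | h
  · have h2 : ‖x‖ ^ s ≤ (1 + ‖x‖) ^ s := Real.rpow_le_rpow hx0.le (by linarith) h
    exact h2.trans (le_mul_of_one_le_left (by positivity) (Real.one_le_rpow hL (abs_nonneg s)))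
  · rw [abs_of_nonpos h, Real.rpow_neg (by positivity), ← Real.inv_rpow (by positivity),
      ← Real.mul_rpow (by positivity) (by positivity)]
    refine Real.rpow_le_rpow_of_nonpos (by positivity) ?_ h
    rw [inv_mul_le_iff₀ (by positivity), add_mul, one_mul, add_comm]
    gcongr
    rw [inv_mul_eq_div, one_le_div hR₀]
    exact hx.le

/-- A decay bound outside a ball with continuous coefficient gives a uniform bound on compact time
intervals. -/
theorem exists_uniform_decay {f : ℝ → EuclideanSpace ℝ (Fin n) → ℝ} {M : ℝ → ℝ}
    {R₀ T s s' : ℝ}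
    (hf : ContinuousOn (fun z : ℝ × EuclideanSpace ℝ (Fin n) => f z.1 z.2) (Ici 0 ×ˢ univ))
    (hM : IsPositiveContinuous M) (hR₀ : 0 < R₀) (hs : s ≤ s')
    (hb : ∀ t, T < t → ∀ x : EuclideanSpace ℝ (Fin n), R₀ < ‖x‖ → f t x ≤ M t * ‖x‖ ^ s)
    {a b : ℝ} (ha : 0 < a) (haT : T < a) :
    ∃ C, 0 ≤ C ∧ ∀ t ∈ Icc a b, ∀ x, f t x ≤ C * (1 + ‖x‖) ^ s' := by
  obtain ⟨L, hL, hLx⟩ := exists_rpow_norm_le_rpow_one_add (E := EuclideanSpace ℝ (Fin n)) hR₀ hs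
  obtain ⟨C₁, hC₁⟩ := (isCompact_Icc (a := a) (b := b)).exists_bound_of_continuousOn
    (hM.1.mono fun t ht => ha.le.trans ht.1)
  -- Inside the ball no decay is assumed; there continuity of the quotient on a compact set gives
  -- the constant.
  have hq : ContinuousOn (fun z : ℝ × EuclideanSpace ℝ (Fin n) =>
      f z.1 z.2 / (1 + ‖z.2‖) ^ s') (Icc a b ×ˢ Metric.closedBall 0 R₀) := by
    refine (hf.mono fun z hz => ⟨ha.le.trans hz.1.1, mem_univ _⟩).div ?_ fun z _ => by positivity
    exact ContinuousOn.rpow_const (by fun_prop) fun z _ => Or.inl (by positivity)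
  obtain ⟨C₂, hC₂⟩ := ((isCompact_Icc (a := a) (b := b)).prod
    (isCompact_closedBall (0 : EuclideanSpace ℝ (Fin n)) R₀)).exists_bound_of_continuousOn hq
  refine ⟨|C₁| * L + |C₂|, by positivity, fun t ht x => ?_⟩
  rcases le_or_gt ‖x‖ R₀ with h | h
  · have h1 := (le_abs_self _).trans (hC₂ (t, x) ⟨ht, by simpa using h⟩)
    rw [div_le_iff₀ (by positivity)] at h1
    refine h1.trans (mul_le_mul_of_nonneg_right ?_ (by positivity))
    linarith [le_abs_self C₂, mul_nonneg (abs_nonneg C₁) hL]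
  · have ht0 : 0 ≤ t := ha.le.trans ht.1
    calc f t x ≤ M t * ‖x‖ ^ s := hb t (haT.trans_le ht.1) x h
      _ ≤ |C₁| * (L * (1 + ‖x‖) ^ s') := by
          refine mul_le_mul ?_ (hLx x h) (by positivity) (abs_nonneg _)
          exact (le_abs_self _).trans ((hC₁ t ht).trans (le_abs_self _))
      _ = |C₁| * L * (1 + ‖x‖) ^ s' := by ring
      _ ≤ _ := by gcongr; linarith [abs_nonneg C₂]

/-- The weight `(1 + |x|)^(-n-ε)` dominating all densities. -/
noncomputable def decayWeight (n : ℕ) (ε : ℝ) (x : EuclideanSpace ℝ (Fin n)) : ℝ :=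
  (1 + ‖x‖) ^ (-((n : ℝ) + ε))

theorem decayWeight_pos (ε : ℝ) (x : EuclideanSpace ℝ (Fin n)) : 0 < decayWeight n ε x := by
  unfold decayWeight; positivity

theorem integrable_decayWeight {ε : ℝ} (hε : 0 < ε) : Integrable (decayWeight n ε) :=
  integrable_one_add_norm (by simpa using hε)

/-- Bounds on the state of the gas that are uniform over a time interval and over all space. -/
theorem IsGlobalGDSolution.exists_uniform_bounds {γ R : ℝ} {w : FluidState n}
    (hw : IsGlobalGDSolution γ R w) {M : DecayCoefficients} {α : DecayExponents} {ε : ℝ}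
    (hMv : IsPositiveContinuous M.v) (hMρ : IsPositiveContinuous M.ρ)
    (hMp : IsPositiveContinuous M.p)
    (hαv : α.v ≤ 1) (hαρ : α.ρ = -(n : ℝ) - 2 - ε) (hαp : α.p = -(n : ℝ) - ε)
    {R₀ T : ℝ} (hR₀ : 0 < R₀)
    (hb : ∀ t : ℝ, T < t → ∀ x : EuclideanSpace ℝ (Fin n), R₀ < ‖x‖ →
      ‖w.velocity t x‖ ≤ M.v t * ‖x‖ ^ α.v ∧ w.density t x ≤ M.ρ t * ‖x‖ ^ α.ρ ∧
      w.pressure t x ≤ M.p t * ‖x‖ ^ α.p)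
    {a b : ℝ} (ha : 0 < a) (haT : T < a) :
    ∃ C, 0 ≤ C ∧ ∀ t ∈ Icc a b, ∀ x,
      w.density t x * (1 + ‖x‖) ^ 2 ≤ C * decayWeight n ε x ∧
      w.pressure t x ≤ C * decayWeight n ε x ∧
      ‖w.velocity t x‖ ≤ C * (1 + ‖x‖) := by
  obtain ⟨C₁, h₁, hC₁⟩ := exists_uniform_decay (b := b) (f := w.density) hw.continuous_density hMρ
    hR₀ hαρ.le (fun t ht x hx => (hb t ht x hx).2.1) ha haT
  obtain ⟨C₂, h₂, hC₂⟩ := exists_uniform_decay (b := b) (f := w.pressure) hw.continuous_pressure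
    hMp hR₀ hαp.le (fun t ht x hx => (hb t ht x hx).2.2) ha haT
  obtain ⟨C₃, h₃, hC₃⟩ := exists_uniform_decay (b := b) (f := fun t x => ‖w.velocity t x‖)
    hw.continuous_velocity.norm hMv hR₀ hαv (fun t ht x hx => (hb t ht x hx).1) ha haT
  refine ⟨C₁ + C₂ + C₃, by positivity, fun t ht x => ⟨?_, ?_, ?_⟩⟩
  · have hx : (0 : ℝ) < 1 + ‖x‖ := by positivity
    calc _ ≤ C₁ * (1 + ‖x‖) ^ (-(n : ℝ) - 2 - ε) * (1 + ‖x‖) ^ 2 := by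
          gcongr; exact hC₁ t ht x
      _ = C₁ * decayWeight n ε x := by
          rw [decayWeight, mul_assoc, ← Real.rpow_natCast, ← Real.rpow_add hx]
          congr 2; push_cast; ring
      _ ≤ _ := by
          gcongr
          · exact (decayWeight_pos ε x).le
          · linarith
  · calc _ ≤ C₂ * (1 + ‖x‖) ^ (-(n : ℝ) - ε) := hC₂ t ht x
      _ = C₂ * decayWeight n ε x := by rw [decayWeight]; congr 2; ring
      _ ≤ _ := by
          gcongr
          · exact (decayWeight_pos ε x).le
          · linarith
  · calc _ ≤ C₃ * (1 + ‖x‖) ^ (1 : ℝ) := hC₃ t ht x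
      _ = C₃ * (1 + ‖x‖) := by rw [Real.rpow_one]
      _ ≤ _ := by gcongr; linarith

end Decay

/-! ### Conservation of mass and energy, and the virial identities. -/

section GasBalance

variable {n : ℕ} {γ R : ℝ} {w : FluidState n}

theorem IsGlobalGDSolution.pressure_nonneg (hw : IsGlobalGDSolution γ R w) (hR : 0 < R) {t : ℝ}
    (ht : 0 ≤ t) (x : EuclideanSpace ℝ (Fin n)) : 0 ≤ w.pressure t x := by
  rw [hw.state_temperature t ht x]
  exact mul_nonneg (mul_nonneg hR.le (hw.density_nonneg t ht x)) (hw.temperature_nonneg t ht x)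

/-- The internal energy `e` has no regularity of its own and enters only through `ρe`. Expressing
`ρe` by the pressure makes the energy density `C¹` and visibly nonnegative. -/
theorem IsGlobalGDSolution.energyDensity_eq (hw : IsGlobalGDSolution γ R w) (hγ : 1 < γ) {t : ℝ}
    (ht : 0 ≤ t) (x : EuclideanSpace ℝ (Fin n)) :
    w.energyDensity t x =
      1 / 2 * (w.density t x * ‖w.velocity t x‖ ^ 2) + (γ - 1)⁻¹ * w.pressure t x := by
  have : γ - 1 ≠ 0 := by linarith
  rw [FluidState.energyDensity, hw.state_energy t ht x]
  field_simp

theorem IsGlobalGDSolution.contDiff_velocity_apply (hw : IsGlobalGDSolution γ R w) (i : Fin n) :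
    ContDiffOn ℝ 1 (fun z : ℝ × EuclideanSpace ℝ (Fin n) => w.velocity z.1 z.2 i)
      (Ioi 0 ×ˢ univ) :=
  contDiffOn_euclidean.1 hw.contDiff_velocity i

theorem IsGlobalGDSolution.contDiff_energyDensity (hw : IsGlobalGDSolution γ R w) (hγ : 1 < γ) :
    ContDiffOn ℝ 1 (fun z : ℝ × EuclideanSpace ℝ (Fin n) => w.energyDensity z.1 z.2)
      (Ioi 0 ×ˢ univ) := by
  have h : ContDiffOn ℝ 1 (fun z : ℝ × EuclideanSpace ℝ (Fin n) =>
      1 / 2 * (w.density z.1 z.2 * ‖w.velocity z.1 z.2‖ ^ 2) + (γ - 1)⁻¹ * w.pressure z.1 z.2)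
      (Ioi 0 ×ˢ univ) :=
    (contDiffOn_const.mul (hw.contDiff_density.mul (hw.contDiff_velocity.norm_sq ℝ))).add
      (contDiffOn_const.mul hw.contDiff_pressure)
  exact h.congr fun z hz => hw.energyDensity_eq hγ (mem_Ioi.1 hz.1).le z.2

/-- The state of the gas on the time interval `[a, b]` decays like that of a gas of finite mass,
energy and moment of inertia, with a common constant `K`. -/
def HasUniformDecay (w : FluidState n) (ε a b K : ℝ) : Prop :=
  ∀ t ∈ Icc a b, ∀ x,
    w.density t x * (1 + ‖x‖) ^ 2 ≤ K * decayWeight n ε x ∧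
    w.density t x * ‖w.velocity t x‖ * (1 + ‖x‖) ≤ K * decayWeight n ε x ∧
    w.density t x * ‖w.velocity t x‖ ^ 2 ≤ K * decayWeight n ε x ∧
    w.pressure t x ≤ K * decayWeight n ε x ∧
    ‖w.velocity t x‖ ≤ K * (1 + ‖x‖)

/-- Each factor `|v|` costs one factor `C(1 + |x|)`, and the density bound has two powers of `1 +
|x|` to spend. The constants needed are `C`, `C²` and `C³`, and their sum serves for all. -/
theorem IsGlobalGDSolution.hasUniformDecay (hw : IsGlobalGDSolution γ R w) {ε a b C : ℝ}
    (ha : 0 < a) (hC : 0 ≤ C)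
    (h : ∀ t ∈ Icc a b, ∀ x,
      w.density t x * (1 + ‖x‖) ^ 2 ≤ C * decayWeight n ε x ∧
      w.pressure t x ≤ C * decayWeight n ε x ∧
      ‖w.velocity t x‖ ≤ C * (1 + ‖x‖)) :
    HasUniformDecay w ε a b (C + C ^ 2 + C ^ 3) := by
  intro t ht x
  obtain ⟨h1, h2, h3⟩ := h t ht x
  have hρ := hw.density_nonneg t (ha.le.trans ht.1) x
  have hg := (decayWeight_pos ε x).le
  have hC2 : 0 ≤ C ^ 2 * decayWeight n ε x := by positivity
  have hC3 : 0 ≤ C ^ 3 * decayWeight n ε x := by positivity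
  have hC1 : 0 ≤ C * decayWeight n ε x := by positivity
  have hx : 0 ≤ 1 + ‖x‖ := by positivity
  refine ⟨by linarith, ?_, ?_, by linarith, ?_⟩
  · calc _ ≤ w.density t x * (C * (1 + ‖x‖)) * (1 + ‖x‖) := by gcongr
      _ = C * (w.density t x * (1 + ‖x‖) ^ 2) := by ring
      _ ≤ C * (C * decayWeight n ε x) := by gcongr
      _ ≤ _ := by linarith
  · calc _ ≤ w.density t x * (C * (1 + ‖x‖)) ^ 2 := by gcongr
      _ = C ^ 2 * (w.density t x * (1 + ‖x‖) ^ 2) := by ring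
      _ ≤ C ^ 2 * (C * decayWeight n ε x) := by gcongr
      _ ≤ _ := by linarith
  · refine h3.trans (mul_le_mul_of_nonneg_right ?_ hx)
    have := pow_nonneg hC 2
    have := pow_nonneg hC 3
    linarith

theorem abs_apply_le_norm (v : EuclideanSpace ℝ (Fin n)) (i : Fin n) : |v i| ≤ ‖v‖ :=
  PiLp.norm_apply_le v i

variable {ε a b K : ℝ}

/-- The balance law with weight `1`, whose gradient is zero. -/
theorem IsGlobalGDSolution.mass_eq (hw : IsGlobalGDSolution γ R w) (hε : 0 < ε) (ha : 0 < a)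
    (hab : a ≤ b) (h : HasUniformDecay w ε a b K) :
    ∫ x, w.density b x = ∫ x, w.density a x := by
  have hzero : ∀ j (x : EuclideanSpace ℝ (Fin n)), spacePartial j (fun _ => (1 : ℝ)) x = 0 :=
    fun j x => by simp [spacePartial]
  have key := (integral_weight_balance (u := w.density)
    (F := fun j t x => w.density t x * w.velocity t x j) (ψ := fun _ => 1)
    (g := fun x => K * decayWeight n ε x) hw.contDiff_density
    (fun j => hw.contDiff_density.mul (hw.contDiff_velocity_apply j)) hw.mass contDiff_const
    ((integrable_decayWeight hε).const_mul K) ha hab ?_ ?_ ?_).2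
  · simpa [hzero, sub_eq_zero] using key
  · intro t ht x
    have hρ := hw.density_nonneg t (ha.le.trans ht.1) x
    rw [one_mul, abs_of_nonneg hρ]
    refine le_trans ?_ (h t ht x).1
    exact le_mul_of_one_le_right hρ (one_le_pow₀ (by linarith [norm_nonneg x]))
  · intro j t ht x
    have hρ := hw.density_nonneg t (ha.le.trans ht.1) x
    have h2 := (h t ht x).2.1
    have h0 : 0 ≤ K * decayWeight n ε x := le_trans (by positivity) h2
    rw [one_mul, abs_mul, abs_of_nonneg hρ]
    calc w.density t x * |w.velocity t x j|
        ≤ w.density t x * ‖w.velocity t x‖ := by gcongr; exact abs_apply_le_norm _ j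
      _ ≤ w.density t x * ‖w.velocity t x‖ * (1 + ‖x‖) :=
          le_mul_of_one_le_right (by positivity) (by linarith [norm_nonneg x])
      _ ≤ K * decayWeight n ε x := h2
      _ ≤ _ := le_mul_of_one_le_left h0 (by linarith [norm_nonneg x])
  · intro j t ht x
    rw [hzero, zero_mul, abs_zero]
    have hρ := hw.density_nonneg t (ha.le.trans ht.1) x
    exact le_trans (by positivity) (h t ht x).1

/-- Again weight `1`. The energy flux is at most `1 + |x|` times an integrable function, because `v`
grows at most linearly; this is the largest flux the balance law tolerates. -/
theorem IsGlobalGDSolution.energy_eq (hw : IsGlobalGDSolution γ R w) (hγ : 1 < γ) (hR : 0 < R)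
    (hε : 0 < ε) (ha : 0 < a) (hab : a ≤ b) (hK : 0 ≤ K) (h : HasUniformDecay w ε a b K) :
    ∫ x, w.energyDensity b x = ∫ x, w.energyDensity a x := by
  have hzero : ∀ j (x : EuclideanSpace ℝ (Fin n)), spacePartial j (fun _ => (1 : ℝ)) x = 0 :=
    fun j x => by simp [spacePartial]
  have hg : ∀ x, 0 ≤ decayWeight n ε x := fun x => (decayWeight_pos ε x).le
  have hγ' : 0 ≤ (γ - 1)⁻¹ := inv_nonneg.2 (by linarith)
  set B := (2 + (γ - 1)⁻¹) * K with hB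
  have hE : ∀ t ∈ Icc a b, ∀ x, 0 ≤ w.energyDensity t x ∧ 0 ≤ w.pressure t x ∧
      w.energyDensity t x + w.pressure t x ≤ B * decayWeight n ε x := by
    intro t ht x
    have ht0 := ha.le.trans ht.1
    have hρ := hw.density_nonneg t ht0 x
    have hp := hw.pressure_nonneg hR ht0 x
    obtain ⟨-, -, h3, h4, -⟩ := h t ht x
    have h5 := mul_le_mul_of_nonneg_left h4 hγ'
    have h0 : 0 ≤ K * decayWeight n ε x := mul_nonneg hK (hg x)
    rw [hw.energyDensity_eq hγ ht0 x]
    refine ⟨by positivity, hp, ?_⟩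
    calc _ ≤ 1 / 2 * (K * decayWeight n ε x) + (γ - 1)⁻¹ * (K * decayWeight n ε x)
          + K * decayWeight n ε x := by gcongr
      _ ≤ _ := by rw [hB]; linarith
  have hB0 : 0 ≤ B := by positivity
  have key := (integral_weight_balance (u := w.energyDensity)
    (F := fun j t x => (w.energyDensity t x + w.pressure t x) * w.velocity t x j)
    (ψ := fun _ => 1)
    (g := fun x => (B + B * K) * decayWeight n ε x) (hw.contDiff_energyDensity hγ)
    (fun j => ((hw.contDiff_energyDensity hγ).add hw.contDiff_pressure).mul
      (hw.contDiff_velocity_apply j)) hw.energy contDiff_const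
    ((integrable_decayWeight hε).const_mul _) ha hab ?_ ?_ ?_).2
  · simpa [hzero, sub_eq_zero] using key
  · intro t ht x
    obtain ⟨h1, h2, h3⟩ := hE t ht x
    rw [one_mul, abs_of_nonneg h1]
    have : 0 ≤ B * K * decayWeight n ε x := mul_nonneg (by positivity) (hg x)
    linarith
  · intro j t ht x
    obtain ⟨h1, h2, h3⟩ := hE t ht x
    rw [one_mul, abs_mul, abs_of_nonneg (add_nonneg h1 h2)]
    have h4 := (abs_apply_le_norm (w.velocity t x) j).trans (h t ht x).2.2.2.2
    calc _ ≤ B * decayWeight n ε x * (K * (1 + ‖x‖)) :=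
          mul_le_mul h3 h4 (abs_nonneg _) (mul_nonneg hB0 (hg x))
      _ = (1 + ‖x‖) * (B * K * decayWeight n ε x) := by ring
      _ ≤ _ := by
          have := hg x
          gcongr
          linarith
  · intro j t ht x
    rw [hzero, zero_mul, abs_zero]
    exact mul_nonneg (by positivity) (hg x)

theorem spacePartial_apply (i j : Fin n) (x : EuclideanSpace ℝ (Fin n)) :
    spacePartial j (fun y => y i) x = if i = j then 1 else 0 := by
  have h := (EuclideanSpace.proj (𝕜 := ℝ) i).hasFDerivAt (x := x)
  have h' : fderiv ℝ (fun y : EuclideanSpace ℝ (Fin n) => y i) x =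
    EuclideanSpace.proj (𝕜 := ℝ) i := h.fderiv
  simp [spacePartial, h']

theorem spacePartial_half_norm_sq (j : Fin n) (x : EuclideanSpace ℝ (Fin n)) :
    spacePartial j (fun y => 1 / 2 * ‖y‖ ^ 2) x = x j := by
  have h := ((hasStrictFDerivAt_norm_sq x).hasFDerivAt.const_mul (1 / 2 : ℝ)).fderiv
  rw [spacePartial, h]
  simp [EuclideanSpace.inner_single_right]

/-- The weight `|x|²/2` has gradient `x`, which turns the mass flux into the radial momentum. The
two extra powers in the decay of the density pay for this weight. -/
theorem IsGlobalGDSolution.inertia_balance (hw : IsGlobalGDSolution γ R w)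
    (hε : 0 < ε) (ha : 0 < a) (hab : a ≤ b) (h : HasUniformDecay w ε a b K) :
    ContinuousOn (fun t => ∫ x, ∑ j, x j * (w.density t x * w.velocity t x j)) (Icc a b) ∧
    (∫ x, 1 / 2 * ‖x‖ ^ 2 * w.density b x) - (∫ x, 1 / 2 * ‖x‖ ^ 2 * w.density a x) =
      ∫ t in a..b, ∫ x, ∑ j, x j * (w.density t x * w.velocity t x j) := by
  have key := integral_weight_balance (u := w.density)
    (F := fun j t x => w.density t x * w.velocity t x j) (ψ := fun x => 1 / 2 * ‖x‖ ^ 2)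
    (g := fun x => K * decayWeight n ε x) hw.contDiff_density
    (fun j => hw.contDiff_density.mul (hw.contDiff_velocity_apply j)) hw.mass
    (contDiff_const.mul (contDiff_norm_sq ℝ))
    ((integrable_decayWeight hε).const_mul K) ha hab ?_ ?_ ?_
  · simpa only [spacePartial_half_norm_sq] using key
  · intro t ht x
    have hρ := hw.density_nonneg t (ha.le.trans ht.1) x
    rw [abs_of_nonneg (by positivity)]
    refine le_trans ?_ (h t ht x).1
    rw [mul_comm]
    gcongr
    nlinarith [norm_nonneg x]
  · intro j t ht x
    have hρ := hw.density_nonneg t (ha.le.trans ht.1) x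
    have h2 := (h t ht x).2.1
    rw [abs_mul, abs_mul (w.density t x), abs_of_nonneg hρ, abs_of_nonneg (by positivity)]
    calc _ ≤ (1 + ‖x‖) ^ 2 * (w.density t x * ‖w.velocity t x‖) := by
          gcongr
          · nlinarith [norm_nonneg x]
          · exact abs_apply_le_norm _ j
      _ = (1 + ‖x‖) * (w.density t x * ‖w.velocity t x‖ * (1 + ‖x‖)) := by ring
      _ ≤ _ := by gcongr
  · intro j t ht x
    have hρ := hw.density_nonneg t (ha.le.trans ht.1) x
    rw [spacePartial_half_norm_sq, abs_mul, abs_mul, abs_of_nonneg hρ]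
    calc _ ≤ (1 + ‖x‖) * (w.density t x * ‖w.velocity t x‖) := by
          gcongr
          · exact (abs_apply_le_norm x j).trans (by linarith)
          · exact abs_apply_le_norm _ j
      _ = w.density t x * ‖w.velocity t x‖ * (1 + ‖x‖) := by ring
      _ ≤ _ := (h t ht x).2.1

/-- The weight `x_i` on the `i`-th momentum equation has gradient `e_i` and so selects the diagonal
entry of the flux tensor; summing over `i` gives the trace `ρ|v|² + n p`. -/
theorem IsGlobalGDSolution.momentum_balance (hw : IsGlobalGDSolution γ R w) (hR : 0 < R)
    (hε : 0 < ε) (ha : 0 < a) (hab : a ≤ b) (h : HasUniformDecay w ε a b K) (i : Fin n) :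
    ContinuousOn (fun t => ∫ x, (w.density t x * w.velocity t x i ^ 2 + w.pressure t x))
      (Icc a b) ∧
    (∫ x, x i * (w.density b x * w.velocity b x i)) -
        (∫ x, x i * (w.density a x * w.velocity a x i)) =
      ∫ t in a..b, ∫ x, (w.density t x * w.velocity t x i ^ 2 + w.pressure t x) := by
  have hFd : ∀ j, ContDiffOn ℝ 1 (fun z : ℝ × EuclideanSpace ℝ (Fin n) =>
      w.density z.1 z.2 * w.velocity z.1 z.2 i * w.velocity z.1 z.2 j) (Ioi 0 ×ˢ univ) :=
    fun j => (hw.contDiff_density.mul (hw.contDiff_velocity_apply i)).mul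
      (hw.contDiff_velocity_apply j)
  have hFabs : ∀ j, ∀ t ∈ Icc a b, ∀ x, |w.density t x * w.velocity t x i * w.velocity t x j +
      (if i = j then 1 else 0) * w.pressure t x| ≤ 2 * K * decayWeight n ε x := by
    intro j t ht x
    have ht0 := ha.le.trans ht.1
    have hρ := hw.density_nonneg t ht0 x
    have hp := hw.pressure_nonneg hR ht0 x
    obtain ⟨-, -, h3, h4, -⟩ := h t ht x
    refine (abs_add_le _ _).trans ?_
    rw [abs_mul, abs_mul, abs_mul, abs_of_nonneg hρ, abs_of_nonneg hp]
    have h5 : w.density t x * |w.velocity t x i| * |w.velocity t x j| ≤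
        w.density t x * ‖w.velocity t x‖ * ‖w.velocity t x‖ := by
      gcongr <;> exact abs_apply_le_norm _ _
    have h6 : |(if i = j then (1 : ℝ) else 0)| * w.pressure t x ≤ w.pressure t x := by
      split_ifs <;> simp [hp]
    linarith
  -- The pressure gradient is written as the divergence of `δ_ij p`, so that the momentum equation
  -- becomes a conservation law with flux `ρ v_i v_j + δ_ij p`.
  have key := integral_weight_balance
    (u := fun t x => w.density t x * w.velocity t x i)
    (F := fun j t x => w.density t x * w.velocity t x i * w.velocity t x j +
      (if i = j then 1 else 0) * w.pressure t x) (ψ := fun x => x i)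
    (g := fun x => 2 * K * decayWeight n ε x)
    (hw.contDiff_density.mul (hw.contDiff_velocity_apply i))
    (fun j => (hFd j).add (contDiffOn_const.mul hw.contDiff_pressure)) ?_
    (EuclideanSpace.proj (𝕜 := ℝ) i).contDiff
    ((integrable_decayWeight hε).const_mul _) ha hab ?_ ?_ ?_
  · simpa [spacePartial_apply, pow_two, mul_assoc] using key
  · intro t ht x
    have h1 := hw.momentum t ht x i
    have h2 : ∀ j, spacePartial j (fun y => w.density t y * w.velocity t y i * w.velocity t y j +
        (if i = j then 1 else 0) * w.pressure t y) x =
        spacePartial j (fun y => w.density t y * w.velocity t y i * w.velocity t y j) x +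
        (if i = j then 1 else 0) * spacePartial j (w.pressure t) x := by
      intro j
      have d1 := hasFDerivAt_space (u := fun t y => w.density t y * w.velocity t y i *
        w.velocity t y j) (hFd j) ht x
      have d2 := hasFDerivAt_space (u := w.pressure) hw.contDiff_pressure ht x
      simp only [spacePartial]
      rw [d1.fderiv, d2.fderiv, (d1.fun_add (d2.const_mul (if i = j then 1 else 0))).fderiv]
      split_ifs <;> simp
    simp_rw [h2]
    simp only [Finset.sum_add_distrib, ite_mul, one_mul, zero_mul, Finset.sum_ite_eq,
      Finset.mem_univ, if_true]
    linarith
  · intro t ht x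
    have hρ := hw.density_nonneg t (ha.le.trans ht.1) x
    have h2 := (h t ht x).2.1
    have h0 : 0 ≤ w.density t x * ‖w.velocity t x‖ * (1 + ‖x‖) := by positivity
    rw [abs_mul, abs_mul, abs_of_nonneg hρ]
    calc _ ≤ (1 + ‖x‖) * (w.density t x * ‖w.velocity t x‖) := by
          gcongr
          · exact (abs_apply_le_norm x i).trans (by linarith)
          · exact abs_apply_le_norm _ i
      _ = w.density t x * ‖w.velocity t x‖ * (1 + ‖x‖) := by ring
      _ ≤ 2 * K * decayWeight n ε x := by linarith
  · intro j t ht x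
    rw [abs_mul]
    exact mul_le_mul ((abs_apply_le_norm x i).trans (by linarith)) (hFabs j t ht x)
      (abs_nonneg _) (by positivity)
  · intro j t ht x
    rw [spacePartial_apply, abs_mul]
    refine le_trans ?_ (hFabs j t ht x)
    refine mul_le_of_le_one_left (abs_nonneg _) ?_
    split_ifs <;> simp

end GasBalance

/-! ### Integrability of the total quantities, and growth of radial momentum and inertia. -/

section Totals

variable {n : ℕ} {γ R : ℝ} {w : FluidState n} {ε a b K : ℝ}

theorem integrable_of_le_decayWeight {f : EuclideanSpace ℝ (Fin n) → ℝ} (hε : 0 < ε)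
    (hf : Continuous f) (h : ∀ x, |f x| ≤ K * decayWeight n ε x) : Integrable f :=
  ((integrable_decayWeight hε).const_mul K).mono' hf.aestronglyMeasurable
    (Eventually.of_forall h)

theorem IsGlobalGDSolution.integrable_density (hw : IsGlobalGDSolution γ R w) (hε : 0 < ε)
    (h : HasUniformDecay w ε a b K) {t : ℝ} (h0 : 0 ≤ t) (ht : t ∈ Icc a b) :
    Integrable (w.density t) := by
  refine integrable_of_le_decayWeight hε (continuousOn_slice hw.continuous_density h0) (K := K)
    fun x => ?_
  have hρ := hw.density_nonneg t h0 x
  rw [abs_of_nonneg hρ]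
  exact (le_mul_of_one_le_right hρ (one_le_pow₀ (by linarith [norm_nonneg x]))).trans
    (h t ht x).1

theorem IsGlobalGDSolution.integrable_inertia (hw : IsGlobalGDSolution γ R w) (hε : 0 < ε)
    (h : HasUniformDecay w ε a b K) {t : ℝ} (h0 : 0 ≤ t) (ht : t ∈ Icc a b) :
    Integrable (fun x => 1 / 2 * ‖x‖ ^ 2 * w.density t x) := by
  have hc := continuousOn_slice hw.continuous_density h0
  refine integrable_of_le_decayWeight hε (by fun_prop) (K := K) fun x => ?_
  have hρ := hw.density_nonneg t h0 x
  rw [abs_of_nonneg (by positivity)]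
  refine le_trans ?_ (h t ht x).1
  rw [mul_comm]
  gcongr
  nlinarith [norm_nonneg x]

theorem IsGlobalGDSolution.integrable_radialMomentum (hw : IsGlobalGDSolution γ R w)
    (hε : 0 < ε) (h : HasUniformDecay w ε a b K) {t : ℝ} (h0 : 0 ≤ t) (ht : t ∈ Icc a b)
    (i : Fin n) : Integrable (fun x => x i * (w.density t x * w.velocity t x i)) := by
  have hc := continuousOn_slice hw.continuous_density h0
  have hv := continuousOn_slice hw.continuous_velocity h0
  refine integrable_of_le_decayWeight hε (by fun_prop) (K := K) fun x => ?_
  have hρ := hw.density_nonneg t h0 x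
  rw [abs_mul, abs_mul, abs_of_nonneg hρ]
  calc _ ≤ (1 + ‖x‖) * (w.density t x * ‖w.velocity t x‖) := by
        gcongr
        · exact (abs_apply_le_norm x i).trans (by linarith)
        · exact abs_apply_le_norm _ i
    _ = w.density t x * ‖w.velocity t x‖ * (1 + ‖x‖) := by ring
    _ ≤ K * decayWeight n ε x := (h t ht x).2.1

theorem IsGlobalGDSolution.integrable_kinetic (hw : IsGlobalGDSolution γ R w) (hε : 0 < ε)
    (h : HasUniformDecay w ε a b K) {t : ℝ} (h0 : 0 ≤ t) (ht : t ∈ Icc a b) :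
    Integrable (fun x => w.density t x * ‖w.velocity t x‖ ^ 2) := by
  have hc := continuousOn_slice hw.continuous_density h0
  have hv := continuousOn_slice hw.continuous_velocity h0
  refine integrable_of_le_decayWeight hε (by fun_prop) (K := K) fun x => ?_
  have hρ := hw.density_nonneg t h0 x
  rw [abs_of_nonneg (by positivity)]
  exact (h t ht x).2.2.1

theorem IsGlobalGDSolution.integrable_kinetic_apply (hw : IsGlobalGDSolution γ R w)
    (hε : 0 < ε) (h : HasUniformDecay w ε a b K) {t : ℝ} (h0 : 0 ≤ t) (ht : t ∈ Icc a b)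
    (i : Fin n) : Integrable (fun x => w.density t x * w.velocity t x i ^ 2) := by
  have hc := continuousOn_slice hw.continuous_density h0
  have hv := continuousOn_slice hw.continuous_velocity h0
  refine (hw.integrable_kinetic hε h h0 ht).mono' (by fun_prop)
    (Eventually.of_forall fun x => ?_)
  have hρ := hw.density_nonneg t h0 x
  rw [Real.norm_of_nonneg (by positivity), ← sq_abs (w.velocity t x i)]
  gcongr
  exact abs_apply_le_norm _ i

theorem IsGlobalGDSolution.integrable_pressure (hw : IsGlobalGDSolution γ R w) (hR : 0 < R)
    (hε : 0 < ε) (h : HasUniformDecay w ε a b K) {t : ℝ} (h0 : 0 ≤ t) (ht : t ∈ Icc a b) :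
    Integrable (w.pressure t) := by
  refine integrable_of_le_decayWeight hε (continuousOn_slice hw.continuous_pressure h0) (K := K)
    fun x => ?_
  rw [abs_of_nonneg (hw.pressure_nonneg hR h0 x)]
  exact (h t ht x).2.2.2.1

theorem IsGlobalGDSolution.integral_energyDensity (hw : IsGlobalGDSolution γ R w) (hγ : 1 < γ)
    (hR : 0 < R) (hε : 0 < ε) (h : HasUniformDecay w ε a b K) {t : ℝ} (h0 : 0 ≤ t)
    (ht : t ∈ Icc a b) :
    ∫ x, w.energyDensity t x = 1 / 2 * (∫ x, w.density t x * ‖w.velocity t x‖ ^ 2) +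
      (γ - 1)⁻¹ * ∫ x, w.pressure t x := by
  simp_rw [hw.energyDensity_eq hγ h0]
  rw [integral_add ((hw.integrable_kinetic hε h h0 ht).const_mul _)
    ((hw.integrable_pressure hR hε h h0 ht).const_mul _), integral_const_mul, integral_const_mul]

theorem IsGlobalGDSolution.sum_integral_momentum_flux (hw : IsGlobalGDSolution γ R w)
    (hR : 0 < R) (hε : 0 < ε) (h : HasUniformDecay w ε a b K) {t : ℝ} (h0 : 0 ≤ t)
    (ht : t ∈ Icc a b) :
    ∑ i, ∫ x, (w.density t x * w.velocity t x i ^ 2 + w.pressure t x) =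
      (∫ x, w.density t x * ‖w.velocity t x‖ ^ 2) + n * ∫ x, w.pressure t x := by
  have hp := hw.integrable_pressure hR hε h h0 ht
  have hk := hw.integrable_kinetic_apply hε h h0 ht
  simp_rw [fun i => integral_add (hk i) hp, Finset.sum_add_distrib]
  rw [← integral_finsetSum _ fun i _ => hk i]
  simp_rw [← Finset.mul_sum, EuclideanSpace.real_norm_sq_eq]
  simp

/-- The virial identity bounds the growth of the radial momentum by the total energy. -/
theorem IsGlobalGDSolution.radialMomentum_growth (hw : IsGlobalGDSolution γ R w) (hγ : 1 < γ)
    (hR : 0 < R) (hε : 0 < ε) (ha : 0 < a) (hab : a ≤ b) (hK : 0 ≤ K)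
    (h : HasUniformDecay w ε a b K) :
    min 2 (n * (γ - 1)) * (∫ x, w.energyDensity a x) * (b - a) ≤
        (∫ x, ∑ j, x j * (w.density b x * w.velocity b x j)) -
          (∫ x, ∑ j, x j * (w.density a x * w.velocity a x j)) ∧
    (∫ x, ∑ j, x j * (w.density b x * w.velocity b x j)) -
          (∫ x, ∑ j, x j * (w.density a x * w.velocity a x j)) ≤
        (2 + n * (γ - 1)) * (∫ x, w.energyDensity a x) * (b - a) := by
  have hpos : ∀ t ∈ Icc a b, 0 ≤ t := fun t ht => ha.le.trans ht.1
  have hsum : (∫ x, ∑ j, x j * (w.density b x * w.velocity b x j)) -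
      (∫ x, ∑ j, x j * (w.density a x * w.velocity a x j)) =
      ∫ t in a..b, ∑ i, ∫ x, (w.density t x * w.velocity t x i ^ 2 + w.pressure t x) := by
    rw [intervalIntegral.integral_finsetSum fun i _ => ContinuousOn.intervalIntegrable
        (by rw [uIcc_of_le hab]; exact (hw.momentum_balance hR hε ha hab h i).1),
      integral_finsetSum _ fun i _ => hw.integrable_radialMomentum hε h
        (hpos b ⟨hab, le_rfl⟩) ⟨hab, le_rfl⟩ i,
      integral_finsetSum _ fun i _ => hw.integrable_radialMomentum hε h
        ha.le ⟨le_rfl, hab⟩ i, ← Finset.sum_sub_distrib]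
    exact Finset.sum_congr rfl fun i _ => (hw.momentum_balance hR hε ha hab h i).2
  have hcont : IntervalIntegrable
      (fun t => ∑ i, ∫ x, (w.density t x * w.velocity t x i ^ 2 + w.pressure t x))
      volume a b := by
    refine ContinuousOn.intervalIntegrable ?_
    rw [uIcc_of_le hab]
    exact continuousOn_finsetSum _ fun i _ => (hw.momentum_balance hR hε ha hab h i).1
  have hγ0 : 0 < γ - 1 := by linarith
  -- With `k = ∫ ρ|v|²` and `q = ∫ p/(γ-1)`, the energy is `k/2 + q` and the flux is `2(k/2) +
  -- n(γ-1) q`; both summands are nonnegative, so the smaller coefficient bounds below and the sum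
  -- of the coefficients bounds above.
  have hest : ∀ t ∈ Icc a b,
      min 2 (n * (γ - 1)) * (∫ x, w.energyDensity a x) ≤
        ∑ i, ∫ x, (w.density t x * w.velocity t x i ^ 2 + w.pressure t x) ∧
      ∑ i, ∫ x, (w.density t x * w.velocity t x i ^ 2 + w.pressure t x) ≤
        (2 + n * (γ - 1)) * (∫ x, w.energyDensity a x) := by
    intro t ht
    have hE : ∫ x, w.energyDensity a x = ∫ x, w.energyDensity t x :=
      (hw.energy_eq hγ hR hε ha ht.1 hK fun s hs x => h s ⟨hs.1, hs.2.trans ht.2⟩ x).symm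
    rw [hE, hw.integral_energyDensity hγ hR hε h (hpos t ht) ht,
      hw.sum_integral_momentum_flux hR hε h (hpos t ht) ht]
    have hk : 0 ≤ ∫ x, w.density t x * ‖w.velocity t x‖ ^ 2 := integral_nonneg fun x =>
      mul_nonneg (hw.density_nonneg t (hpos t ht) x) (by positivity)
    have hp : 0 ≤ ∫ x, w.pressure t x := integral_nonneg fun x =>
      hw.pressure_nonneg hR (hpos t ht) x
    generalize (∫ x, w.density t x * ‖w.velocity t x‖ ^ 2) = k at hk ⊢
    generalize (∫ x, w.pressure t x) = p at hp ⊢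
    have hq : 0 ≤ (γ - 1)⁻¹ * p := by positivity
    have hpq : p = (γ - 1) * ((γ - 1)⁻¹ * p) := by field_simp
    generalize (γ - 1)⁻¹ * p = q at hq hpq
    subst hpq
    constructor
    · have h1 : min 2 ((n : ℝ) * (γ - 1)) * (1 / 2 * k) ≤ 2 * (1 / 2 * k) := by
        gcongr; exact min_le_left _ _
      have h2 : min 2 ((n : ℝ) * (γ - 1)) * q ≤ n * (γ - 1) * q := by
        gcongr; exact min_le_right _ _
      linarith
    · have h1 : 0 ≤ n * (γ - 1) * (1 / 2 * k) := by positivity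
      linarith
  rw [hsum]
  constructor
  · have := intervalIntegral.integral_mono_on hab intervalIntegrable_const hcont
      fun t ht => (hest t ht).1
    rw [intervalIntegral.integral_const, smul_eq_mul] at this
    linarith
  · have := intervalIntegral.integral_mono_on hab hcont intervalIntegrable_const
      fun t ht => (hest t ht).2
    rw [intervalIntegral.integral_const, smul_eq_mul] at this
    linarith

/-- A function whose derivative grows linearly grows quadratically. -/
theorem quadratic_growth {G H : ℝ → ℝ} {t₁ c C : ℝ} (ht₁ : 0 < t₁) (hc : 0 < c)
    (hH : ∀ a b, t₁ ≤ a → a ≤ b → c * (b - a) ≤ H b - H a ∧ H b - H a ≤ C * (b - a))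
    (hHc : ∀ a b, t₁ ≤ a → a ≤ b → ContinuousOn H (Icc a b))
    (hG : ∀ a b, t₁ ≤ a → a ≤ b → G b - G a = ∫ t in a..b, H t)
    (hG0 : ∀ t, t₁ ≤ t → 0 ≤ G t) :
    ∃ c' C', 0 < c' ∧ 0 < C' ∧ ∀ᶠ t in atTop,
      c' * t ≤ H t ∧ c' * t ^ 2 ≤ G t ∧ G t ≤ C' * t ^ 2 := by
  -- Beyond this threshold the initial value and the time shift cost at most half of the slope `c`.
  have hlin : ∀ᶠ t in atTop, |H t₁| + (c + |C|) * t₁ ≤ c / 2 * t :=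
    (tendsto_id.const_mul_atTop (by positivity : 0 < c / 2)).eventually_ge_atTop _
  obtain ⟨t₂, ht₂⟩ := (hlin.and (eventually_ge_atTop t₁)).exists_forall_of_atTop
  have ht12 : t₁ ≤ t₂ := (ht₂ t₂ le_rfl).2
  have ht20 : 0 < t₂ := ht₁.trans_le ht12
  have hb : ∀ t, t₂ ≤ t → c / 2 * t ≤ H t ∧ H t ≤ (|C| + c) * t := by
    intro t ht
    obtain ⟨h1, h2⟩ := ht₂ t ht
    obtain ⟨h3, h4⟩ := hH t₁ t le_rfl h2
    have h5 : C * (t - t₁) ≤ |C| * (t - t₁) :=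
      mul_le_mul_of_nonneg_right (le_abs_self C) (by linarith)
    have h6 : 0 ≤ |C| * t₁ := by positivity
    have h7 : 0 ≤ c * t₁ := by positivity
    have h8 : 0 < c * t := mul_pos hc (by linarith)
    constructor
    · linarith [neg_abs_le (H t₁)]
    · linarith [le_abs_self (H t₁)]
  have hint : ∀ k t : ℝ, ∫ s in t₂..t, k * s = k / 2 * (t ^ 2 - t₂ ^ 2) := by
    intro k t
    rw [intervalIntegral.integral_const_mul, integral_id]
    ring
  have hlini : ∀ k t : ℝ, IntervalIntegrable (fun s => k * s) volume t₂ t := fun k t =>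
    (continuous_const_mul k).intervalIntegrable t₂ t
  have hGb : ∀ t, t₂ ≤ t → c / 4 * (t ^ 2 - t₂ ^ 2) ≤ G t - G t₂ ∧
      G t - G t₂ ≤ (|C| + c) / 2 * (t ^ 2 - t₂ ^ 2) := by
    intro t ht
    have hi : IntervalIntegrable H volume t₂ t := ContinuousOn.intervalIntegrable
      (by rw [uIcc_of_le ht]; exact hHc t₂ t ht12 ht)
    rw [hG t₂ t ht12 ht]
    constructor
    · have := intervalIntegral.integral_mono_on ht (hlini (c / 2) t) hi
        fun s hs => (hb s hs.1).1
      rw [hint] at this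
      linarith
    · have := intervalIntegral.integral_mono_on ht hi (hlini (|C| + c) t)
        fun s hs => (hb s hs.1).2
      rw [hint] at this
      linarith
  -- For `t ≥ 2t₂` one has `t² - t₂² ≥ 3t²/4`, more than enough for `c/8`; for `t ≥ 1` the constant
  -- `G t₂` is absorbed into `G t₂ · t²`.
  refine ⟨c / 8, |C| + c + G t₂, by positivity, ?_, ?_⟩
  · have := hG0 t₂ ht12
    positivity
  filter_upwards [eventually_ge_atTop (2 * t₂), eventually_ge_atTop 1] with t ht ht1
  have ht2 : t₂ ≤ t := by linarith
  obtain ⟨h1, h2⟩ := hb t ht2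
  obtain ⟨h3, h4⟩ := hGb t ht2
  have h5 := hG0 t₂ ht12
  have h6 : 4 * t₂ ^ 2 ≤ t ^ 2 := by nlinarith
  have h7 : 1 ≤ t ^ 2 := by nlinarith
  refine ⟨?_, ?_, ?_⟩
  · have : 0 < c * t := mul_pos hc (by linarith)
    linarith
  · have : c * (4 * t₂ ^ 2) ≤ c * t ^ 2 := by gcongr
    have : 0 ≤ c * t ^ 2 := by positivity
    linarith
  · have h8 : G t₂ * 1 ≤ G t₂ * t ^ 2 := by gcongr
    have h9 : 0 ≤ (|C| + c) * t₂ ^ 2 := by positivity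
    have h10 : 0 ≤ (|C| + c) * t ^ 2 := by positivity
    linarith

end Totals

/-! ### Upper bounds by splitting space at a radius, and integration in time. -/

section Growth

variable {n : ℕ} {γ R : ℝ} {w : FluidState n} {ε a b K : ℝ}

theorem integral_decayWeight_inv_smul {r : ℝ} (hr : 0 < r) :
    ∫ x : EuclideanSpace ℝ (Fin n), decayWeight n ε (r⁻¹ • x) =
      r ^ n * ∫ x, decayWeight n ε x := by
  rw [Measure.integral_comp_inv_smul_of_nonneg _ _ hr.le]
  simp

/-- For `|x| > r` one has `1 + |x|/r ≤ 2|x|/r`, so the tail is dominated by a rescaled integrable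
weight. Scaling then gives a tail integral of order `r^(-ε)` without polar coordinates. -/
theorem rpow_norm_le_decayWeight (hε : 0 < ε) {r : ℝ} (hr : 0 < r)
    {x : EuclideanSpace ℝ (Fin n)} (hx : r < ‖x‖) :
    ‖x‖ ^ (-((n : ℝ) + ε)) ≤
      2 ^ ((n : ℝ) + ε) * r ^ (-((n : ℝ) + ε)) * decayWeight n ε (r⁻¹ • x) := by
  have hx0 : 0 < ‖x‖ := hr.trans hx
  have h1 : 1 + ‖r⁻¹ • x‖ ≤ 2 * (r⁻¹ * ‖x‖) := by
    rw [norm_smul, norm_inv, Real.norm_of_nonneg hr.le]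
    have : 1 ≤ r⁻¹ * ‖x‖ := by
      rw [inv_mul_eq_div, one_le_div hr]
      exact hx.le
    linarith
  have h2 : (2 * (r⁻¹ * ‖x‖)) ^ (-((n : ℝ) + ε)) ≤ decayWeight n ε (r⁻¹ • x) :=
    Real.rpow_le_rpow_of_nonpos (by positivity) h1
      (neg_nonpos.2 (by positivity))
  calc ‖x‖ ^ (-((n : ℝ) + ε))
      = 2 ^ ((n : ℝ) + ε) * r ^ (-((n : ℝ) + ε)) * (2 * (r⁻¹ * ‖x‖)) ^ (-((n : ℝ) + ε)) := by
        rw [Real.mul_rpow (by positivity) (by positivity),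
          Real.mul_rpow (by positivity) (by positivity), Real.inv_rpow hr.le,
          Real.rpow_neg zero_le_two]
        field_simp
    _ ≤ _ := by gcongr

/-- The moment of inertia is bounded by the mass inside a ball and the decay of the density
outside. -/
theorem IsGlobalGDSolution.inertia_le (hw : IsGlobalGDSolution γ R w) (hε : 0 < ε)
    (h : HasUniformDecay w ε a b K) {t : ℝ} (h0 : 0 ≤ t) (ht : t ∈ Icc a b) {r m : ℝ}
    (hr : 0 < r) (hm : 0 ≤ m)
    (hd : ∀ x, r < ‖x‖ → w.density t x ≤ m * ‖x‖ ^ (-(n : ℝ) - 2 - ε)) :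
    ∫ x, 1 / 2 * ‖x‖ ^ 2 * w.density t x ≤ 1 / 2 * (r ^ 2 * (∫ x, w.density t x) +
      m * 2 ^ ((n : ℝ) + ε) * (∫ x, decayWeight n ε x) * r ^ (-ε)) := by
  have hg : Integrable (fun x : EuclideanSpace ℝ (Fin n) => decayWeight n ε (r⁻¹ • x)) :=
    (integrable_decayWeight hε).comp_smul (inv_ne_zero hr.ne')
  have hρ := hw.integrable_density hε h h0 ht
  -- Both terms on the right are nonnegative, so each may be used only in its own region although
  -- both are integrated over all space.
  have hpt : ∀ x, 1 / 2 * ‖x‖ ^ 2 * w.density t x ≤ 1 / 2 * (r ^ 2 * w.density t x +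
      m * (2 ^ ((n : ℝ) + ε) * r ^ (-((n : ℝ) + ε))) * decayWeight n ε (r⁻¹ • x)) := by
    intro x
    have hρ0 := hw.density_nonneg t h0 x
    have hg0 := (decayWeight_pos ε (r⁻¹ • x)).le
    rw [mul_assoc]
    refine mul_le_mul_of_nonneg_left ?_ (by norm_num)
    rcases le_or_gt ‖x‖ r with hx | hx
    · have h1 : ‖x‖ ^ 2 * w.density t x ≤ r ^ 2 * w.density t x := by gcongr
      refine h1.trans (le_add_of_nonneg_right (by positivity))
    · have hx0 : 0 < ‖x‖ := hr.trans hx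
      have h1 : ‖x‖ ^ 2 * w.density t x ≤ m * ‖x‖ ^ (-((n : ℝ) + ε)) := by
        calc _ ≤ ‖x‖ ^ 2 * (m * ‖x‖ ^ (-(n : ℝ) - 2 - ε)) := by gcongr; exact hd x hx
          _ = m * (‖x‖ ^ (2 : ℝ) * ‖x‖ ^ (-(n : ℝ) - 2 - ε)) := by
              rw [Real.rpow_two]; ring
          _ = _ := by rw [← Real.rpow_add hx0]; congr 2; ring
      have h2 := mul_le_mul_of_nonneg_left (rpow_norm_le_decayWeight hε hr hx) hm
      have h3 : 0 ≤ r ^ 2 * w.density t x := by positivity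
      linarith
  calc _ ≤ ∫ x, 1 / 2 * (r ^ 2 * w.density t x +
      m * (2 ^ ((n : ℝ) + ε) * r ^ (-((n : ℝ) + ε))) * decayWeight n ε (r⁻¹ • x)) :=
        integral_mono (hw.integrable_inertia hε h h0 ht)
          (((hρ.const_mul _).add (hg.const_mul _)).const_mul _) hpt
    _ = _ := by
        rw [integral_const_mul, integral_add (hρ.const_mul _) (hg.const_mul _),
          integral_const_mul, integral_const_mul, integral_decayWeight_inv_smul hr,
          show (-ε : ℝ) = -((n : ℝ) + ε) + (n : ℕ) by ring, Real.rpow_add hr,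
          Real.rpow_natCast]
        ring

/-- The radial momentum is bounded by mass and energy inside a ball and by the velocity bound
times the moment of inertia outside. -/
theorem IsGlobalGDSolution.radialMomentum_le (hw : IsGlobalGDSolution γ R w) (hγ : 1 < γ)
    (hR : 0 < R) (hε : 0 < ε) (h : HasUniformDecay w ε a b K) {t : ℝ} (h0 : 0 ≤ t)
    (ht : t ∈ Icc a b) {r m s : ℝ} (hr : 0 < r) (hm : 0 ≤ m) (hs : s ≤ 1)
    (hv : ∀ x, r < ‖x‖ → ‖w.velocity t x‖ ≤ m * ‖x‖ ^ s) :
    ∫ x, ∑ j, x j * (w.density t x * w.velocity t x j) ≤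
      r * ((∫ x, w.density t x) + ∫ x, w.energyDensity t x) +
        2 * m * r ^ (s - 1) * ∫ x, 1 / 2 * ‖x‖ ^ 2 * w.density t x := by
  have hρi := hw.integrable_density hε h h0 ht
  have hI := hw.integrable_inertia hε h h0 ht
  have hk := hw.integrable_kinetic hε h h0 ht
  have hpt : ∀ x, ∑ j, x j * (w.density t x * w.velocity t x j) ≤
      (r * w.density t x + r * (1 / 2 * (w.density t x * ‖w.velocity t x‖ ^ 2))) +
        2 * m * r ^ (s - 1) * (1 / 2 * ‖x‖ ^ 2 * w.density t x) := by
    intro x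
    have hρ := hw.density_nonneg t h0 x
    have h1 : ∑ j, x j * (w.density t x * w.velocity t x j) ≤
        w.density t x * (‖x‖ * ‖w.velocity t x‖) := by
      have := real_inner_le_norm (w.velocity t x) x
      rw [PiLp.inner_apply] at this
      simp only [RCLike.inner_apply, conj_trivial] at this
      calc _ = w.density t x * ∑ j, x j * w.velocity t x j := by
            rw [Finset.mul_sum]
            exact Finset.sum_congr rfl fun j _ => by ring
        _ ≤ _ := by
          rw [mul_comm ‖x‖]
          gcongr
    refine h1.trans ?_
    rcases le_or_gt ‖x‖ r with hx | hx
    · have h2 : w.density t x * (‖x‖ * ‖w.velocity t x‖) ≤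
          w.density t x * (r * ‖w.velocity t x‖) := by gcongr
      -- Inside the ball this splits the momentum into mass and kinetic energy, both controlled by
      -- conserved totals.
      have h3 : ‖w.velocity t x‖ ≤ 1 + 1 / 2 * ‖w.velocity t x‖ ^ 2 := by
        nlinarith [sq_nonneg (‖w.velocity t x‖ - 1)]
      have h4 : w.density t x * (r * ‖w.velocity t x‖) ≤
          w.density t x * (r * (1 + 1 / 2 * ‖w.velocity t x‖ ^ 2)) := by gcongr
      have h5 : 0 ≤ 2 * m * r ^ (s - 1) * (1 / 2 * ‖x‖ ^ 2 * w.density t x) := by positivity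
      linarith
    · have hx0 : 0 < ‖x‖ := hr.trans hx
      -- Since `s ≤ 1`, the power `|x|^(s-1)` decreases, which leaves `|x|²ρ`, the density of
      -- inertia.
      have h2 : ‖x‖ ^ s ≤ r ^ (s - 1) * ‖x‖ := by
        calc ‖x‖ ^ s = ‖x‖ ^ (s - 1) * ‖x‖ := by
              rw [← Real.rpow_add_one hx0.ne', sub_add_cancel]
          _ ≤ _ := mul_le_mul_of_nonneg_right
            (Real.rpow_le_rpow_of_nonpos hr hx.le (by linarith)) hx0.le
      have h3 : w.density t x * (‖x‖ * ‖w.velocity t x‖) ≤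
          w.density t x * (‖x‖ * (m * (r ^ (s - 1) * ‖x‖))) := by
        gcongr
        exact (hv x hx).trans (by gcongr)
      have h4 : 0 ≤ r * w.density t x := by positivity
      have h5 : 0 ≤ r * (1 / 2 * (w.density t x * ‖w.velocity t x‖ ^ 2)) := by positivity
      linarith
  have hint := integral_mono
    (integrable_finsetSum _ fun j _ => hw.integrable_radialMomentum hε h h0 ht j)
    (((hρi.const_mul r).add ((hk.const_mul (1 / 2)).const_mul r)).add
      (hI.const_mul (2 * m * r ^ (s - 1)))) hpt
  refine hint.trans ?_
  rw [integral_add' ((hρi.const_mul r).add ((hk.const_mul (1 / 2)).const_mul r))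
      (hI.const_mul (2 * m * r ^ (s - 1))),
    integral_add' (hρi.const_mul r) ((hk.const_mul (1 / 2)).const_mul r),
    integral_const_mul, integral_const_mul, integral_const_mul, integral_const_mul,
    hw.integral_energyDensity hγ hR hε h h0 ht, mul_add]
  have hp : 0 ≤ ∫ x, w.pressure t x := integral_nonneg fun x => hw.pressure_nonneg hR h0 x
  have hγ' : 0 ≤ (γ - 1)⁻¹ := inv_nonneg.2 (by linarith)
  have : 0 ≤ r * ((γ - 1)⁻¹ * ∫ x, w.pressure t x) := by positivity
  linarith

theorem isBigO_of_mul_le {f g : ℝ → ℝ} {c : ℝ} (hc : 0 < c) (hg : ∀ᶠ t in atTop, 0 ≤ g t)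
    (h : ∀ᶠ t in atTop, c * g t ≤ f t) : g =O[atTop] f := by
  refine IsBigO.of_bound c⁻¹ ?_
  filter_upwards [hg, h] with t h1 h2
  rw [Real.norm_of_nonneg h1, Real.norm_of_nonneg (le_trans (by positivity) h2),
    inv_mul_eq_div, le_div_iff₀ hc]
  linarith

/-- Lower bounds on a positive function by a power integrate. -/
theorem isBigO_integral_of_rpow_le {m : ℝ → ℝ} {k s : ℝ} (hm : IsPositiveContinuous m)
    (hk : 0 < k) (h : ∀ᶠ t in atTop, k * t ^ (-s) ≤ m t) :
    (s = 1 → (fun t : ℝ => Real.log t) =O[atTop] (fun t : ℝ => ∫ τ in (0 : ℝ)..t, m τ)) ∧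
    (s < 1 → (fun t : ℝ => t ^ (1 - s)) =O[atTop] (fun t : ℝ => ∫ τ in (0 : ℝ)..t, m τ)) := by
  obtain ⟨t₀, ht₀⟩ := (h.and (eventually_ge_atTop 1)).exists_forall_of_atTop
  have h1 : 1 ≤ t₀ := (ht₀ t₀ le_rfl).2
  have h0 : 0 < t₀ := by linarith
  have hmi : ∀ p q, 0 ≤ p → p ≤ q → IntervalIntegrable m volume p q := fun p q hp hpq =>
    (hm.1.mono fun x hx => by
      rw [uIcc_of_le hpq] at hx
      exact hp.trans hx.1).intervalIntegrable
  have hlow : ∀ t, t₀ ≤ t → k * (∫ τ in t₀..t, τ ^ (-s)) ≤ ∫ τ in (0 : ℝ)..t, m τ := by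
    intro t ht
    rw [← intervalIntegral.integral_add_adjacent_intervals (hmi 0 t₀ le_rfl h0.le)
      (hmi t₀ t h0.le ht), ← intervalIntegral.integral_const_mul]
    have h2 : 0 ≤ ∫ τ in (0 : ℝ)..t₀, m τ :=
      intervalIntegral.integral_nonneg h0.le fun τ hτ => (hm.2 τ hτ.1).le
    have h3 : ∫ τ in t₀..t, k * τ ^ (-s) ≤ ∫ τ in t₀..t, m τ := by
      refine intervalIntegral.integral_mono_on ht (ContinuousOn.intervalIntegrable ?_)
        (hmi t₀ t h0.le ht) fun τ hτ => (ht₀ τ hτ.1).1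
      refine continuousOn_const.mul (ContinuousOn.rpow_const continuousOn_id fun τ hτ => ?_)
      rw [uIcc_of_le ht] at hτ
      exact Or.inl (h0.trans_le hτ.1).ne'
    linarith
  constructor
  · rintro rfl
    -- The factor `1/2` absorbs the lower endpoint `t₀` once `log t ≥ 2 log t₀`; the power case
    -- below does the same.
    refine isBigO_of_mul_le (c := k / 2) (by positivity) ?_ ?_
    · filter_upwards [eventually_ge_atTop 1] with t ht using Real.log_nonneg ht
    · filter_upwards [eventually_ge_atTop t₀,
        Real.tendsto_log_atTop.eventually_ge_atTop (2 * Real.log t₀)] with t ht hl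
      refine le_trans ?_ (hlow t ht)
      have htp : 0 < t := h0.trans_le ht
      simp_rw [Real.rpow_neg_one]
      rw [integral_inv_of_pos h0 htp, Real.log_div htp.ne' h0.ne', div_mul_eq_mul_div,
        mul_div_assoc]
      gcongr
      linarith
  · intro hs
    have hs' : 0 < 1 - s := by linarith
    refine isBigO_of_mul_le (c := k / (2 * (1 - s))) (by positivity) ?_ ?_
    · filter_upwards [eventually_ge_atTop 0] with t ht using by positivity
    · filter_upwards [eventually_ge_atTop t₀,
        (tendsto_rpow_atTop hs').eventually_ge_atTop (2 * t₀ ^ (1 - s))] with t ht hl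
      refine le_trans ?_ (hlow t ht)
      rw [integral_rpow (Or.inl (by linarith)), show -s + 1 = 1 - s by ring,
        div_mul_eq_mul_div, mul_div_assoc]
      refine mul_le_mul_of_nonneg_left ?_ hk.le
      rw [div_le_div_iff₀ (by positivity) hs']
      have := mul_le_mul_of_nonneg_right hl hs'.le
      linarith

end Growth

/-! ### Conclusion: comparing the growth with the decay bounds. -/

/-- Choice of a small radius factor absorbing a fixed multiple. -/
theorem exists_pos_mul_le {A c : ℝ} (hA : 0 ≤ A) (hc : 0 < c) : ∃ δ : ℝ, 0 < δ ∧ δ * A ≤ c :=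
  ⟨c / (A + 1), by positivity, by
    rw [div_mul_eq_mul_div, div_le_iff₀ (by positivity)]
    nlinarith⟩

/-- Growth at least like `g` is `g =O[atTop] f`: eventually `f t ≥ c * g t` with some `c > 0`.
The gas is not energetically trivial: its energy density does not vanish identically from some
time on. -/
theorem theorem2 {n : ℕ} (hn : 1 ≤ n) {γ R : ℝ} (hγ : 1 < γ) (hR : 0 < R)
    (w : FluidState n) (hw : IsGlobalGDSolution γ R w)
    (hE : ∃ᶠ t in atTop, ∃ x, 0 < w.energyDensity t x)
    (M : DecayCoefficients) (α : DecayExponents) (ε : ℝ) (hK : IsOfClassKGD w M α ε) :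
    (fun t : ℝ => t ^ (2 + ε)) =O[atTop] M.ρ ∧
    (α.v = 1 → (fun t : ℝ => Real.log t) =O[atTop] (fun t : ℝ => ∫ τ in (0 : ℝ)..t, M.v τ)) ∧
    (α.v < 1 →
      (fun t : ℝ => t ^ (1 - α.v)) =O[atTop] (fun t : ℝ => ∫ τ in (0 : ℝ)..t, M.v τ)) := by
  obtain ⟨⟨hMv, -, hMρ, hMp, -, R₀, T, hR₀, hT, hbd⟩, hε, hαv, hαρ, hαp⟩ := hK
  -- The constant `K` depends on the interval and only justifies integrability and balance laws; it
  -- does not enter the final rates.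
  have hdec : ∀ a b, T < a → a ≤ b → ∃ K, 0 ≤ K ∧ HasUniformDecay w ε a b K := by
    intro a b haT _
    have ha : 0 < a := hT.trans_lt haT
    obtain ⟨C, hC, h⟩ := hw.exists_uniform_bounds (b := b) hMv hMρ hMp hαv hαρ hαp hR₀
      (fun t ht x hx => ⟨(hbd t ht x hx).1, (hbd t ht x hx).2.2.1, (hbd t ht x hx).2.2.2.1⟩)
      ha haT
    exact ⟨_, by positivity, hw.hasUniformDecay ha hC h⟩
  -- A single time after `T` with nonzero energy density suffices, because the total energy is
  -- conserved from then on.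
  obtain ⟨t₁, ht₁, x₁, hx₁⟩ := hE.forall_exists_of_atTop (T + 1)
  have hT₁ : T < t₁ := by linarith
  have h0₁ : 0 < t₁ := hT.trans_lt hT₁
  set m := ∫ x, w.density t₁ x with hm
  set E := ∫ x, w.energyDensity t₁ x with hEdef
  have hγ' : 0 < γ - 1 := by linarith
  have hmass : ∀ t, t₁ ≤ t → ∫ x, w.density t x = m := fun t ht => by
    obtain ⟨K, -, h⟩ := hdec t₁ t hT₁ ht
    exact hw.mass_eq hε h0₁ ht h
  have henergy : ∀ t, t₁ ≤ t → ∫ x, w.energyDensity t x = E := fun t ht => by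
    obtain ⟨K, hK, h⟩ := hdec t₁ t hT₁ ht
    exact hw.energy_eq hγ hR hε h0₁ ht hK h
  have hm0 : 0 ≤ m := integral_nonneg (hw.density_nonneg t₁ h0₁.le)
  have hE0 : 0 < E := by
    obtain ⟨K, hK, h⟩ := hdec t₁ t₁ hT₁ le_rfl
    have ht : t₁ ∈ Icc t₁ t₁ := ⟨le_rfl, le_rfl⟩
    have hi : Integrable (w.energyDensity t₁) := by
      rw [funext (hw.energyDensity_eq hγ h0₁.le)]
      exact ((hw.integrable_kinetic hε h h0₁.le ht).const_mul _).add
        ((hw.integrable_pressure hR hε h h0₁.le ht).const_mul _)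
    have hc : Continuous (w.energyDensity t₁) :=
      continuousOn_slice (hw.contDiff_energyDensity hγ).continuousOn h0₁
    refine integral_pos_of_integrable_nonneg_nonzero hc hi (fun x => ?_) hx₁.ne'
    rw [hw.energyDensity_eq hγ h0₁.le]
    have := hw.density_nonneg t₁ h0₁.le x
    have := hw.pressure_nonneg hR h0₁.le x
    positivity
  have hc0 : 0 < min 2 ((n : ℝ) * (γ - 1)) * E := by
    have : (0 : ℝ) < n := by exact_mod_cast hn
    positivity
  obtain ⟨c, C, hc, hC, hgrow⟩ := quadratic_growth
    (G := fun t => ∫ x, 1 / 2 * ‖x‖ ^ 2 * w.density t x)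
    (H := fun t => ∫ x, ∑ j, x j * (w.density t x * w.velocity t x j))
    (C := (2 + n * (γ - 1)) * E) h0₁ hc0
    (fun a b ha hab => by
      obtain ⟨K, hK, h⟩ := hdec a b (hT₁.trans_le ha) hab
      have := hw.radialMomentum_growth hγ hR hε (h0₁.trans_le ha) hab hK h
      rwa [henergy a ha] at this)
    (fun a b ha hab => by
      obtain ⟨K, hK, h⟩ := hdec a b (hT₁.trans_le ha) hab
      exact (hw.inertia_balance hε (h0₁.trans_le ha) hab h).1)
    (fun a b ha hab => by
      obtain ⟨K, hK, h⟩ := hdec a b (hT₁.trans_le ha) hab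
      exact (hw.inertia_balance hε (h0₁.trans_le ha) hab h).2)
    (fun t ht => integral_nonneg fun x => by
      have := hw.density_nonneg t (h0₁.le.trans ht) x
      positivity)
  refine ⟨?_, ?_⟩
  -- With `δ²m ≤ c` the inner part `(δt)²m/2` is at most half of the lower bound `c t²` for the
  -- inertia.
  · obtain ⟨δ', hδ', hδm⟩ := exists_pos_mul_le hm0 hc
    obtain ⟨δ, hδ, rfl⟩ : ∃ δ : ℝ, 0 < δ ∧ δ ^ 2 = δ' :=
      ⟨√δ', Real.sqrt_pos.2 hδ', Real.sq_sqrt hδ'.le⟩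
    have hI : 0 ≤ ∫ x, decayWeight n ε x := integral_nonneg fun x => (decayWeight_pos ε x).le
    set A := 2 ^ ((n : ℝ) + ε) * (∫ x, decayWeight n ε x) * δ ^ (-ε) with hA
    have hA0 : 0 ≤ A := by positivity
    -- Only `A ≥ 0` is known, hence the denominator `A + 1`.
    refine isBigO_of_mul_le (c := c / (A + 1)) (by positivity) ?_ ?_
    · filter_upwards [eventually_ge_atTop 0] with t ht using by positivity
    -- Times beyond `R₀/δ` make the splitting radius `δt` exceed `R₀`, so the decay bounds hold on
    -- the whole outer region.
    filter_upwards [hgrow, eventually_ge_atTop t₁, eventually_gt_atTop (R₀ / δ)]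
      with t hg ht htR
    have ht0 : 0 < t := h0₁.trans_le ht
    obtain ⟨K, hK, h⟩ := hdec t t (hT₁.trans_le ht) le_rfl
    have hr : R₀ < δ * t := by rwa [div_lt_iff₀ hδ, mul_comm] at htR
    have hM := hMρ.2 t ht0.le
    have key := hw.inertia_le hε h ht0.le ⟨le_rfl, le_rfl⟩ (hR₀.trans hr) hM.le
      fun x hx => by
        have := (hbd t (hT₁.trans_le ht) x (hr.trans hx)).2.2.1
        rwa [hαρ] at this
    rw [hmass t ht, Real.mul_rpow hδ.le ht0.le] at key
    have h1 : c * t ^ 2 ≤ A * M.ρ t * t ^ (-ε) := by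
      have h2 : δ ^ 2 * m * t ^ 2 ≤ c * t ^ 2 := by gcongr
      have h3 := hg.2.1.trans key
      rw [hA]
      linarith
    have h4 : c * t ^ (2 + ε) ≤ A * M.ρ t := by
      have h5 := mul_le_mul_of_nonneg_right h1 (Real.rpow_nonneg ht0.le ε)
      rwa [mul_assoc, mul_assoc, ← Real.rpow_add ht0, neg_add_cancel, Real.rpow_zero, mul_one,
        ← Real.rpow_two, ← Real.rpow_add ht0] at h5
    rw [div_mul_eq_mul_div, div_le_iff₀ (by positivity)]
    linarith
  -- With `δ(m + E) ≤ c/2` the inner part takes at most half of the linear growth `c t`.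
  · obtain ⟨δ, hδ, hδm⟩ := exists_pos_mul_le (add_nonneg hm0 hE0.le) (half_pos hc)
    have hδα : 0 < δ ^ (α.v - 1) := Real.rpow_pos_of_pos hδ _
    refine isBigO_integral_of_rpow_le (k := c / (4 * C * δ ^ (α.v - 1))) hMv (by positivity) ?_
    filter_upwards [hgrow, eventually_ge_atTop t₁, eventually_gt_atTop (R₀ / δ)]
      with t hg ht htR
    have ht0 : 0 < t := h0₁.trans_le ht
    obtain ⟨K, hK, h⟩ := hdec t t (hT₁.trans_le ht) le_rfl
    have hr : R₀ < δ * t := by rwa [div_lt_iff₀ hδ, mul_comm] at htR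
    have hM := hMv.2 t ht0.le
    have key := hw.radialMomentum_le hγ hR hε h ht0.le ⟨le_rfl, le_rfl⟩ (hR₀.trans hr) hM.le
      hαv fun x hx => (hbd t (hT₁.trans_le ht) x (hr.trans hx)).1
    rw [hmass t ht, henergy t ht, Real.mul_rpow hδ.le ht0.le] at key
    have htα : t ^ (α.v - 1) * t ^ 2 = t ^ α.v * t := by
      rw [← Real.rpow_two, ← Real.rpow_add ht0, ← Real.rpow_add_one ht0.ne']
      congr 1
      ring
    -- The outer term must carry `c t/2`, and the inertia is at most `C t²`; the factors `2` and `2`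
    -- give the `4` in `k`.
    have h1 : c * t ≤ 4 * C * δ ^ (α.v - 1) * M.v t * (t ^ α.v * t) := by
      have h2 : δ * (m + E) * t ≤ c / 2 * t := by gcongr
      have h3 : 2 * M.v t * (δ ^ (α.v - 1) * t ^ (α.v - 1)) *
          (∫ x, 1 / 2 * ‖x‖ ^ 2 * w.density t x) ≤
          2 * M.v t * (δ ^ (α.v - 1) * t ^ (α.v - 1)) * (C * t ^ 2) := by
        gcongr
        exact hg.2.2
      have h4 := hg.1.trans key
      rw [← htα]
      linarith
    have h5 : c ≤ 4 * C * δ ^ (α.v - 1) * M.v t * t ^ α.v := by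
      rw [← mul_assoc] at h1
      exact le_of_mul_le_mul_right h1 ht0
    rw [Real.rpow_neg ht0.le, ← div_eq_mul_inv, div_le_iff₀ (by positivity),
      div_le_iff₀ (by positivity)]
    linarith
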